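/- Let $\Omega$ be a non-empty finite set and $\Delta(\Omega)\subset\mathbb{R}^\Omega$ the set of probability distributions on $\Omega$. At every stage $m=1,2,\dots$ the player chooses a prediction $p_m\in\Delta(\Omega)$ and, simultaneously, Nature chooses a state $\omega_m\in\Omega$; both are then observed. A strategy $\sigma$ of the player (resp. $\tau$ of Nature) maps every finite history $(p_1,\omega_1,\dots,p_m,\omega_m)$, measurably, to a probability distribution on $\Delta(\Omega)$ (resp. on $\Omega$); the choices of one stage are independent given the past. Let $\mathbb{P}_{\sigma,\tau}$ be the induced law of the infinite play and $\mathbb{E}_{\sigma,\tau}$ its expectation. Let $J\subset\Omega$ be either $\Omega$ or $\Omega$ minus one element, according to whether $\Delta(\Omega)$ is regarded as a subset of $\mathbb{R}^{\Omega}$ or, by dropping one coordinate, of $\mathbb{R}^{|\Omega|-1}$. Put $\|x\|_\infty=\max_{i\in J}|x_i|$ (with value $0$ if $J=\emptyset$) and $\|x\|=(\sum_{i\in J}x_i^2)^{1/2}$. For $p\in\Delta(\Omega)$ and $\lambda>0$ let $\mathbb{N}_n[p,\lambda]=\{m\le n:\ \|p_m-p\|_\infty\le\lambda\}$, and let $$\overline\omega_n[p,\lambda]=\frac{1}{|\mathbb{N}_n[p,\lambda]|}\sum_{m\in\mathbb{N}_n[p,\lambda]}\delta_{\omega_m},\qquad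 \overline p_n[p,\lambda]=\frac{1}{|\mathbb{N}_n[p,\lambda]|}\sum_{m\in\mathbb{N}_n[p,\lambda]}p_m$$ be the empirical distribution of the states and the average prediction on these stages (terms with $\mathbb{N}_n[p,\lambda]=\emptyset$ below count as $0$). Then there is a strategy $\sigma$ of the player that is calibrated with respect to the family of all $\ell_\infty$-balls, i.e. for every strategy $\tau$ of Nature $$\limsup_{n\to\infty}\ \sup_{p\in\Delta(\Omega),\,\lambda>0}\frac{|\mathbb{N}_n[p,\lambda]|}{n}\Big\|\overline\omega_n[p,\lambda]-\overline p_n[p,\lambda]\Big\|\le 0\qquad \mathbb{P}_{\sigma,\tau}\text{-almost surely},$$ and such that, for every strategy $\tau$ of Nature and every integer $n\ge|\Omega|$, the supremum below is $\mathbb{P}_{\sigma,\tau}$-integrable and $$\mathbb{E}_{\sigma,\tau}\left[\sup_{p\in\Delta(\Omega),\,\lambda>0}\frac{|\mathbb{N}_n[p,\lambda]|}{n}\Big\|\overline\omega_n[p,\lambda]-\overline p_n[p,\lambda]\Big\|_\infty\right]\le 12\sqrt{2\,\frac{|\Omega|}{n}\log\!\Big(\frac{2n}{|\Omega|}\Big)}.$$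 -/

import Mathlib

open MeasureTheory ProbabilityTheory Filter

namespace Calibration

/-- `Δ(Ω)`: the probability distributions on the finite set `Ω`. -/
abbrev Prediction (Ω : Type*) [Fintype Ω] : Type _ := stdSimplex ℝ Ω

/-- What is observed at one stage: the prediction of the player and the state chosen by Nature. -/
abbrev Stage (Ω : Type*) [Fintype Ω] : Type _ := Prediction Ω × Ω

/-- A behavioural strategy of an agent with action space `A`. Stages are numbered from `0`:
`first` is the law of the action at stage `0` and `next n h` is the law of the action at stage
`n + 1` when the history of the stages `0, …, n` is `h`. The player has `A = Δ(Ω)`, Nature has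
`A = Ω`. -/
structure Strategy (Ω : Type*) [Fintype Ω] [MeasurableSpace Ω] (A : Type*)
    [MeasurableSpace A] where
  first : Measure A
  next : (n : ℕ) → Kernel ((_ : Finset.Iic n) → Stage Ω) A
  isProbabilityMeasure_first : IsProbabilityMeasure first
  isMarkovKernel_next : ∀ n, IsMarkovKernel (next n)

attribute [instance] Strategy.isProbabilityMeasure_first Strategy.isMarkovKernel_next

/-- The law of the infinite play: at every stage, given the past, the prediction and the
state are drawn independently according to the two strategies. -/
noncomputable def playLaw {Ω : Type*} [Fintype Ω] [MeasurableSpace Ω]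
    (σ : Strategy Ω (Prediction Ω)) (τ : Strategy Ω Ω) : Measure (ℕ → Stage Ω) :=
  Kernel.trajMeasure (X := fun _ => Stage Ω) (σ.first.prod τ.first)
    (fun n => (σ.next n).prod (τ.next n))

section Scores

variable {Ω : Type*} [Fintype Ω]

open Classical in
/-- Among the first `n` stages, those at which the prediction was in `F`. -/
noncomputable def activeStages (F : Set (Prediction Ω)) (n : ℕ) (h : ℕ → Stage Ω) : Finset ℕ :=
  (Finset.range n).filter fun m => (h m).1 ∈ F

open Classical in
/-- The empirical distribution of the states on the active stages. -/
noncomputable def empirical (F : Set (Prediction Ω)) (n : ℕ) (h : ℕ → Stage Ω) : Ω → ℝ :=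
  ((activeStages F n h).card : ℝ)⁻¹ • ∑ m ∈ activeStages F n h, Pi.single (h m).2 (1 : ℝ)

/-- The average prediction on the active stages. -/
noncomputable def avgPrediction (F : Set (Prediction Ω)) (n : ℕ) (h : ℕ → Stage Ω) : Ω → ℝ :=
  ((activeStages F n h).card : ℝ)⁻¹ • ∑ m ∈ activeStages F n h, ((h m).1 : Ω → ℝ)

/-- The frequency of the active stages. -/
noncomputable def frequency (F : Set (Prediction Ω)) (n : ℕ) (h : ℕ → Stage Ω) : ℝ :=
  ((activeStages F n h).card : ℝ) / n

/-- The coordinates indexed by `J` of the difference between the empirical distribution and the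
average prediction. -/
noncomputable def gap (J : Finset Ω) (F : Set (Prediction Ω)) (n : ℕ) (h : ℕ → Stage Ω) :
    J → ℝ :=
  J.restrict (empirical F n h - avgPrediction F n h)

/-- Calibration score over a family of sets, measured with the sup norm of `ℝ^J`. -/
noncomputable def supScore (J : Finset Ω) (𝓕 : Set (Set (Prediction Ω))) (n : ℕ)
    (h : ℕ → Stage Ω) : ℝ :=
  ⨆ F : 𝓕, frequency (F : Set (Prediction Ω)) n h * ‖gap J F n h‖

/-- Calibration score over a family of sets, measured with the Euclidean norm of `ℝ^J`. -/
noncomputable def euclideanScore (J : Finset Ω) (𝓕 : Set (Set (Prediction Ω))) (n : ℕ)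
    (h : ℕ → Stage Ω) : ℝ :=
  ⨆ F : 𝓕, frequency (F : Set (Prediction Ω)) n h *
    ‖(WithLp.toLp 2 (gap J F n h) : EuclideanSpace ℝ J)‖

/-- The trace on `Δ(Ω)` of the closed ball of `ℝ^J`, for the sup norm, with centre `p` and
radius `r`. -/
def supBall (J : Finset Ω) (p : Prediction Ω) (r : ℝ) : Set (Prediction Ω) :=
  {q | ‖J.restrict ((q : Ω → ℝ) - (p : Ω → ℝ))‖ ≤ r}

/-- The family of all sup-norm balls with centre in `Δ(Ω)` and positive radius. -/
def supBalls (J : Finset Ω) : Set (Set (Prediction Ω)) :=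
  {F | ∃ p : Prediction Ω, ∃ r : ℝ, 0 < r ∧ F = supBall J p r}

/-- `𝓕`-calibration: against every strategy of Nature, the score over `𝓕` is almost surely
asymptotically nonpositive. -/
def IsCalibrated [MeasurableSpace Ω] (J : Finset Ω) (𝓕 : Set (Set (Prediction Ω)))
    (σ : Strategy Ω (Prediction Ω)) : Prop :=
  ∀ τ : Strategy Ω Ω, ∀ᵐ h ∂(playLaw σ τ),
    limsup (fun n : ℕ => euclideanScore J 𝓕 n h) atTop ≤ 0

end Scores

end Calibration

namespace Calibration

/-! Calibration is reduced to a finite problem of prediction with expert advice. If all predictions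
lie on the grid of mesh `1 / K`, an `ℓ_∞`-ball selects the same predictions as some box with grid
corners (`exists_box`), so only finitely many tests matter. Each triple (box, coordinate, sign) is
an expert whose payoff is the signed prediction error, counted when the prediction falls in the box;
the score is then controlled by the largest cumulative payoff. For exponential weights with rate `η`
that maximum exceeds the sum of the weighted mean payoffs by at most `log |E| / η + η n`, on every
path (`cumulative_le`).

It remains to keep the mean payoff small. Against a known mixed state `q`, predicting a grid point
within `1 / K` of `q` makes every expert's expected payoff at most `1 / K`; by minimax
(`exists_mixed_of_forall_exists_pure`) some law on the grid achieves this for the weighted payoff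
against every state (`exists_law`).

Independence of `n` comes from restarting on blocks of geometric length, with mesh and rate tuned to
each block (`geometricSchedule`). Almost sure calibration then follows from the bound in expectation
alone: expected scores are summable along `k ^ 8`, and the slow variation of the score fills the
gaps (`tendsto_supScore_of_tendsto_pow`). -/

/-! ### Exponential weights. -/

/-- One step of the exponential weights inequality. -/
theorem sum_exp_mul_exp_le {E : Type*} [Fintype E] [Nonempty E] {η : ℝ} (hη0 : 0 ≤ η) (hη1 : η ≤ 1)
    (c x : E → ℝ) (hx : ∀ e, |x e| ≤ 1) :
    ∑ e, Real.exp (c e + η * x e) ≤ (∑ e, Real.exp (c e)) *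
      Real.exp (η * ((∑ e, Real.exp (c e) * x e) / ∑ e, Real.exp (c e)) + η ^ 2) := by
  have hW : 0 < ∑ e, Real.exp (c e) :=
    Finset.sum_pos (fun e _ => Real.exp_pos _) Finset.univ_nonempty
  -- This is `exp y ≤ 1 + y + y ^ 2` for `|y| ≤ 1`; after averaging, `1 + z ≤ exp z` returns to
  -- exponential form.
  have step : ∀ e, Real.exp (c e + η * x e) ≤ Real.exp (c e) * (1 + η * x e + η ^ 2) := by
    intro e
    rw [Real.exp_add]
    refine mul_le_mul_of_nonneg_left ?_ (Real.exp_pos _).le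
    have h1 : |η * x e| ≤ η := by
      rw [abs_mul, abs_of_nonneg hη0]
      exact mul_le_of_le_one_right hη0 (hx e)
    have h2 := Real.abs_exp_sub_one_sub_id_le (h1.trans hη1)
    have h3 : (η * x e) ^ 2 ≤ η ^ 2 := sq_le_sq' (by linarith [neg_abs_le (η * x e)])
      ((le_abs_self _).trans h1)
    have h4 := (abs_le.1 h2).2
    linarith
  calc ∑ e, Real.exp (c e + η * x e)
      ≤ ∑ e, Real.exp (c e) * (1 + η * x e + η ^ 2) := Finset.sum_le_sum fun e _ => step e
    _ = (∑ e, Real.exp (c e)) *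
        ((η * ((∑ e, Real.exp (c e) * x e) / ∑ e, Real.exp (c e)) + η ^ 2) + 1) := by
        have : ∀ e, Real.exp (c e) * (1 + η * x e + η ^ 2) =
            η * (Real.exp (c e) * x e) + (1 + η ^ 2) * Real.exp (c e) := fun e => by ring
        simp_rw [this, Finset.sum_add_distrib, ← Finset.mul_sum]
        field_simp
        ring
    _ ≤ _ := mul_le_mul_of_nonneg_left (Real.add_one_le_exp _) hW.le

/-- The cumulative payoff, before stage `n`, of every expert over the stages of colour `j`. -/
def cumulative {E : Type*} (κ : ℕ → ℕ) (j : ℕ) (x : ℕ → E → ℝ) (n : ℕ) (e : E) : ℝ :=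
  ∑ l ∈ Finset.range n with κ l = j, x l e

/-- The average payoff at stage `n` for the exponential weights with rate `η`. -/
noncomputable def meanPayoff {E : Type*} [Fintype E] (κ : ℕ → ℕ) (j : ℕ) (η : ℝ)
    (x : ℕ → E → ℝ) (n : ℕ) : ℝ :=
  (∑ e, Real.exp (η * cumulative κ j x n e) * x n e) /
    ∑ e, Real.exp (η * cumulative κ j x n e)

/-- The potential starts at `card E`, is multiplied by the one-step factor at stages of colour `j`,
and does not move at the others. -/
theorem sum_exp_cumulative_le {E : Type*} [Fintype E] [Nonempty E] (κ : ℕ → ℕ) (j : ℕ) {η : ℝ}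
    (hη0 : 0 ≤ η) (hη1 : η ≤ 1) (x : ℕ → E → ℝ) (hx : ∀ l e, |x l e| ≤ 1) (n : ℕ) :
    ∑ e, Real.exp (η * cumulative κ j x n e) ≤ Fintype.card E *
      Real.exp (∑ l ∈ Finset.range n with κ l = j, (η * meanPayoff κ j η x l + η ^ 2)) := by
  induction n with
  | zero => simp [cumulative]
  | succ n ih =>
    by_cases h : κ n = j
    · have h1 := sum_exp_mul_exp_le hη0 hη1 (fun e => η * cumulative κ j x n e) (x n) (hx n)
      have h2 : ∀ e, η * cumulative κ j x (n + 1) e = η * cumulative κ j x n e + η * x n e := by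
        intro e
        simp only [cumulative, Finset.sum_filter, Finset.sum_range_succ, if_pos h]
        ring
      simp only [h2]
      refine h1.trans ?_
      rw [Finset.sum_filter, Finset.sum_range_succ, ← Finset.sum_filter, if_pos h,
        Real.exp_add (∑ l ∈ Finset.range n with κ l = j, _), ← mul_assoc]
      exact mul_le_mul_of_nonneg_right ih (Real.exp_pos _).le
    · have h2 : ∀ e, cumulative κ j x (n + 1) e = cumulative κ j x n e := by
        intro e
        simp only [cumulative, Finset.sum_filter, Finset.sum_range_succ, if_neg h, add_zero]
      simp only [h2]
      rwa [Finset.sum_filter, Finset.sum_range_succ, ← Finset.sum_filter, if_neg h, add_zero]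

/-- Pathwise regret bound for exponential weights. -/
theorem cumulative_le {E : Type*} [Fintype E] (κ : ℕ → ℕ) (j : ℕ) {η : ℝ}
    (hη0 : 0 < η) (hη1 : η ≤ 1) (x : ℕ → E → ℝ) (hx : ∀ l e, |x l e| ≤ 1) (n : ℕ) (e : E) :
    cumulative κ j x n e ≤ Real.log (Fintype.card E) / η +
      ∑ l ∈ Finset.range n with κ l = j, (η + meanPayoff κ j η x l) := by
  have : Nonempty E := ⟨e⟩
  have h1 : Real.exp (η * cumulative κ j x n e) ≤ Fintype.card E *
      Real.exp (∑ l ∈ Finset.range n with κ l = j, (η * meanPayoff κ j η x l + η ^ 2)) :=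
    (Finset.single_le_sum (f := fun e => Real.exp (η * cumulative κ j x n e))
      (fun e _ => (Real.exp_pos _).le) (Finset.mem_univ e)).trans
      (sum_exp_cumulative_le κ j hη0.le hη1 x hx n)
  have h2 := Real.log_le_log (Real.exp_pos _) h1
  rw [Real.log_exp, Real.log_mul (by simp) (Real.exp_pos _).ne', Real.log_exp] at h2
  have h3 : ∑ l ∈ Finset.range n with κ l = j, (η * meanPayoff κ j η x l + η ^ 2) =
      η * ∑ l ∈ Finset.range n with κ l = j, (η + meanPayoff κ j η x l) := by
    rw [Finset.mul_sum]
    exact Finset.sum_congr rfl fun l _ => by ring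
  rw [h3] at h2
  rw [div_add' _ _ _ hη0.ne', le_div_iff₀ hη0]
  linarith

/-! ### Minimax by separation. -/

/-- The minimax theorem for finite games, in the form of a theorem of the alternative. -/
theorem exists_mixed_of_forall_exists_pure {A B : Type*} [Fintype A] [Fintype B] [Nonempty B]
    (V : A → B → ℝ) (ε : ℝ)
    (h : ∀ q ∈ stdSimplex ℝ B, ∃ a, ∑ b, q b * V a b ≤ ε) :
    ∃ μ ∈ stdSimplex ℝ A, ∀ b, ∑ a, μ a * V a b ≤ ε := by
  classical
  by_contra! H
  set Φ : (A → ℝ) →ₗ[ℝ] (B → ℝ) := (Matrix.of V).vecMulLinear with hΦ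
  have hΦa : ∀ μ b, Φ μ b = ∑ a, μ a * V a b := fun μ b => rfl
  -- If the alternative fails, the compact convex set of achievable payoff vectors misses the closed
  -- orthant below `ε`, so a linear functional `f` separates them strictly.
  have hdisj : Disjoint (Φ '' stdSimplex ℝ A) (Set.Iic fun _ => ε) := by
    rw [Set.disjoint_left]
    rintro _ ⟨μ, hμ, rfl⟩ hxt
    obtain ⟨b, hb⟩ := H μ hμ
    exact hb.not_ge (hxt b)
  obtain ⟨f, u, v, hu, huv, hv⟩ := geometric_hahn_banach_compact_closed
    ((convex_stdSimplex ℝ A).linear_image Φ)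
    ((isCompact_stdSimplex ℝ A).image Φ.continuous_of_finiteDimensional)
    (convex_Iic _) isClosed_Iic hdisj
  have hf : ∀ x : B → ℝ, f x = ∑ b, x b * f (Pi.single b 1) := by
    intro x
    conv_lhs => rw [pi_eq_sum_univ' x]
    simp [map_sum]
  -- The orthant contains rays in the directions `-e_b`; a positive coordinate of `f` would drive
  -- `f` below `v` along such a ray, and `M` is far enough for that.
  have hneg : ∀ b, f (Pi.single b 1) ≤ 0 := by
    intro b
    by_contra! hb
    set M : ℝ := max 0 ((f (fun _ => ε) - v) / f (Pi.single b 1)) with hM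
    have h1 := hv ((fun _ => ε) - M • Pi.single b 1) (by
      rw [Set.mem_Iic, sub_le_self_iff]
      exact smul_nonneg (le_max_left _ _) (Pi.single_nonneg.2 zero_le_one))
    rw [map_sub, map_smul, smul_eq_mul] at h1
    have h2 := (div_le_iff₀ hb).1 (le_max_right 0 ((f (fun _ => ε) - v) / f (Pi.single b 1)))
    linarith
  set C : ℝ := ∑ b, -f (Pi.single b 1) with hC
  have hC0 : 0 ≤ C := Finset.sum_nonneg fun b _ => neg_nonneg.2 (hneg b)
  have hε : v < -(ε * C) := by
    have h1 := hv (fun _ => ε) (by simp)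
    rw [hf] at h1
    simpa [hC, Finset.mul_sum] using h1
  have hpure : ∀ a, f (V a) < u := by
    intro a
    refine hu _ ⟨Pi.single a 1, single_mem_stdSimplex ℝ a, ?_⟩
    ext b
    simp [hΦa, Pi.single_apply]
  -- If `C = 0` then `f = 0`, which cannot separate strictly. Otherwise `-f / C` is a mixed action
  -- on `B`, and the pure reply given by `h` contradicts the separation.
  rcases hC0.eq_or_lt with hC1 | hC1
  · have h0 : ∀ b, f (Pi.single b 1) = 0 := fun b => by
      have := (Finset.sum_eq_zero_iff_of_nonneg
        (fun b _ => neg_nonneg.2 (hneg b))).1 hC1.symm b (Finset.mem_univ b)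
      linarith
    obtain ⟨a, -⟩ := h _ (single_mem_stdSimplex ℝ (Classical.arbitrary B))
    have h1 := hpure a
    rw [hf] at h1
    simp only [h0, mul_zero, Finset.sum_const_zero] at h1
    rw [← hC1] at hε
    linarith
  · obtain ⟨a, ha⟩ := h (fun b => -f (Pi.single b 1) / C)
      ⟨fun b => div_nonneg (neg_nonneg.2 (hneg b)) hC0, by
        rw [← Finset.sum_div, ← hC, div_self hC1.ne']⟩
    have h1 := hpure a
    have h2 : ∑ b, -f (Pi.single b 1) / C * V a b = -f (V a) / C := by
      rw [hf (V a), ← Finset.sum_neg_distrib, Finset.sum_div]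
      exact Finset.sum_congr rfl fun b _ => by ring
    rw [h2, div_le_iff₀ hC1] at ha
    linarith

/-! ### Grids, boxes and experts. -/

section Experts

variable {Ω : Type*} [Fintype Ω]

/-- The predictions whose coordinates are integer multiples of `1 / K`. -/
def grid (Ω : Type*) [Fintype Ω] (K : ℕ) : Set (Prediction Ω) :=
  {p | ∃ c : Ω → ℕ, ∀ i, p i = c i / K}

theorem grid_finite {K : ℕ} (hK : 0 < K) : (grid Ω K).Finite := by
  have hK' : (0 : ℝ) < K := Nat.cast_pos.2 hK
  refine Set.Finite.of_finite_image (f := Subtype.val) ((Set.Finite.pi' fun _ : Ω =>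
    ((Set.finite_Iic K).image fun c : ℕ => (c / K : ℝ))).subset ?_) Subtype.val_injective.injOn
  rintro _ ⟨p, ⟨c, hc⟩, rfl⟩ i
  refine ⟨c i, ?_, (hc i).symm⟩
  have h1 : p i ≤ 1 := stdSimplex.le_one p i
  rw [hc i, div_le_one hK'] at h1
  exact_mod_cast h1

/-- Every prediction is close to the grid. -/
theorem exists_mem_grid_abs_sub_le {K : ℕ} (hK : 0 < K) (q : Prediction Ω) :
    ∃ g ∈ grid Ω K, ∀ i, |q i - g i| ≤ 1 / K := by
  classical
  have hK' : (0 : ℝ) < K := Nat.cast_pos.2 hK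
  have hq : ∑ i, (K : ℝ) * q i = K := by rw [← Finset.mul_sum, stdSimplex.sum_eq_one, mul_one]
  have hle : ∀ i, (⌊K * q i⌋₊ : ℝ) ≤ K * q i := fun i =>
    Nat.floor_le (mul_nonneg hK'.le (stdSimplex.zero_le q i))
  have hlt : ∀ i, K * q i < (⌊K * q i⌋₊ : ℝ) + 1 := fun i => Nat.lt_floor_add_one _
  have h1 : ∑ i, ⌊K * q i⌋₊ ≤ K := by
    have : ((∑ i, ⌊K * q i⌋₊ : ℕ) : ℝ) ≤ K := by
      push_cast
      exact (Finset.sum_le_sum fun i _ => hle i).trans hq.le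
    exact_mod_cast this
  have h2 : K - ∑ i, ⌊K * q i⌋₊ ≤ (Finset.univ : Finset Ω).card := by
    have : (K : ℝ) ≤ ((∑ i, (⌊K * q i⌋₊ + 1) : ℕ) : ℝ) := by
      push_cast
      exact hq.ge.trans (Finset.sum_le_sum fun i _ => (hlt i).le)
    have h3 : K ≤ ∑ i, (⌊K * q i⌋₊ + 1) := by exact_mod_cast this
    rw [Finset.sum_add_distrib, Finset.sum_const, smul_eq_mul, mul_one] at h3
    omega
  -- Rounding every coordinate down leaves a deficit of at most `|Ω|` units of `1 / K`; rounding up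
  -- on a set `T` of exactly that size restores total mass one.
  obtain ⟨T, -, hT⟩ := Finset.exists_subset_card_eq h2
  set c : Ω → ℕ := fun i => ⌊K * q i⌋₊ + if i ∈ T then 1 else 0 with hc
  have hcsum : ∑ i, c i = K := by
    simp only [hc, Finset.sum_add_distrib, Finset.sum_boole, Finset.filter_mem_eq_inter,
      Finset.univ_inter, hT, Nat.cast_id]
    omega
  have hcS : (fun i => (c i / K : ℝ)) ∈ stdSimplex ℝ Ω := by
    refine ⟨fun i => by positivity, ?_⟩
    rw [← Finset.sum_div, ← Nat.cast_sum, hcsum, div_self hK'.ne']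
  refine ⟨⟨_, hcS⟩, ⟨c, fun i => rfl⟩, fun i => ?_⟩
  change |q i - c i / K| ≤ 1 / K
  have h4 : q i - c i / K = (K * q i - c i) / K := by field_simp
  rw [h4, abs_div, abs_of_pos hK']
  refine div_le_div_of_nonneg_right (abs_le.2 ?_) hK'.le
  have h5 := hle i
  have h6 := hlt i
  simp only [hc]
  split_ifs <;> push_cast <;> constructor <;> linarith

/-- The experts: a box with corners on the grid, a coordinate and a sign. -/
abbrev Expert (J : Finset Ω) (K : ℕ) : Type _ := (J → Fin (K + 1) × Fin (K + 1)) × J × Bool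

noncomputable instance (J : Finset Ω) (K : ℕ) : Fintype (Expert J K) := Fintype.ofFinite _

theorem card_expert (J : Finset Ω) (K : ℕ) :
    Fintype.card (Expert J K) = ((K + 1) ^ 2) ^ J.card * (2 * J.card) := by
  rw [← Nat.card_eq_fintype_card, Nat.card_prod, Nat.card_fun, Nat.card_prod, Nat.card_prod]
  simp
  ring

/-- The predictions whose coordinates in `J` lie between the given multiples of `1 / K`. -/
def box (J : Finset Ω) (K : ℕ) (b : J → Fin (K + 1) × Fin (K + 1)) : Set (Prediction Ω) :=
  {p | ∀ i : J, ((b i).1 : ℕ) / (K : ℝ) ≤ p i ∧ p i ≤ ((b i).2 : ℕ) / (K : ℝ)}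

open Classical in
/-- The error of the prediction of one stage in the coordinate `i`, counted only when the
prediction is in `F`. -/
noncomputable def stageError (F : Set (Prediction Ω)) (i : Ω) (s : Stage Ω) : ℝ :=
  if s.1 ∈ F then (if s.2 = i then 1 else 0) - s.1 i else 0

/-- The payoff of an expert at one stage. -/
noncomputable def payoff (J : Finset Ω) (K : ℕ) (e : Expert J K) (s : Stage Ω) : ℝ :=
  (if e.2.2 then 1 else -1) * stageError (box J K e.1) e.2.1 s

theorem abs_stageError_le (F : Set (Prediction Ω)) (i : Ω) (s : Stage Ω) :
    |stageError F i s| ≤ 1 := by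
  have h0 := stdSimplex.zero_le s.1 i
  have h1 := stdSimplex.le_one s.1 i
  rw [stageError, abs_le]
  split_ifs <;> constructor <;> linarith

theorem abs_payoff_le (J : Finset Ω) (K : ℕ) (e : Expert J K) (s : Stage Ω) :
    |payoff J K e s| ≤ 1 := by
  rw [payoff, abs_mul]
  have := abs_stageError_le (box J K e.1) e.2.1 s
  split_ifs <;> simpa using this

/-- When the state has law `q`, the mean error in coordinate `i` of a prediction `g` in the box is
`q i - g i`; outside the box the payoff vanishes. -/
theorem sum_mul_payoff_le (J : Finset Ω) (K : ℕ) (e : Expert J K) (q g : Prediction Ω) {ε : ℝ}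
    (hε : 0 ≤ ε) (h : ∀ i, |q i - g i| ≤ ε) : ∑ ω, q ω * payoff J K e (g, ω) ≤ ε := by
  classical
  simp only [payoff, stageError]
  by_cases hg : g ∈ box J K e.1
  · have h1 : ∑ ω, q ω * ((if e.2.2 then (1 : ℝ) else -1) *
        ((if ω = (e.2.1 : Ω) then 1 else 0) - g e.2.1)) =
        (if e.2.2 then (1 : ℝ) else -1) * (q e.2.1 - g e.2.1) := by
      have : ∀ ω, q ω * ((if e.2.2 then (1 : ℝ) else -1) *
          ((if ω = (e.2.1 : Ω) then 1 else 0) - g e.2.1)) = (if e.2.2 then (1 : ℝ) else -1) *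
          ((if ω = (e.2.1 : Ω) then q ω else 0) - q ω * g e.2.1) := fun ω => by
        split_ifs <;> ring
      simp_rw [this]
      rw [← Finset.mul_sum, Finset.sum_sub_distrib, ← Finset.sum_mul, stdSimplex.sum_eq_one]
      simp
    simp only [hg, if_true]
    rw [h1]
    have := abs_le.1 (h e.2.1)
    split_ifs <;> linarith
  · simpa [hg] using hε

theorem measurableSet_box (J : Finset Ω) (K : ℕ) (b : J → Fin (K + 1) × Fin (K + 1)) :
    MeasurableSet (box J K b) := by
  have hm : ∀ i : Ω, Measurable fun p : Prediction Ω => p i := fun i =>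
    (measurable_pi_apply i).comp measurable_subtype_coe
  rw [box, Set.ofPred_forall]
  exact MeasurableSet.iInter fun i => (measurableSet_le measurable_const (hm i)).inter
    (measurableSet_le (hm i) measurable_const)

theorem measurable_payoff [MeasurableSpace Ω] [DiscreteMeasurableSpace Ω] (J : Finset Ω) (K : ℕ)
    (e : Expert J K) : Measurable (payoff J K e) := by
  classical
  have hm : ∀ i : Ω, Measurable fun p : Prediction Ω => p i := fun i =>
    (measurable_pi_apply i).comp measurable_subtype_coe
  unfold payoff stageError
  refine measurable_const.mul (Measurable.ite (measurable_fst (measurableSet_box J K e.1))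
    (Measurable.sub (Measurable.ite ?_ measurable_const measurable_const)
      ((hm _).comp measurable_fst)) measurable_const)
  exact measurable_snd (MeasurableSet.of_discrete (s := {ω | ω = (e.2.1 : Ω)}))

/-- A mixed prediction on the grid that makes the weighted payoff of the experts small. -/
theorem exists_law [Nonempty Ω] (J : Finset Ω) {K : ℕ} (hK : 0 < K) (w : Expert J K → ℝ)
    (hw : ∀ e, 0 ≤ w e) :
    ∃ ν : Measure (Prediction Ω), IsProbabilityMeasure ν ∧ (∀ᵐ p ∂ν, p ∈ grid Ω K) ∧
      ∀ ω, ∫ p, ∑ e, w e * payoff J K e (p, ω) ∂ν ≤ 1 / K * ∑ e, w e := by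
  classical
  have := (grid_finite (Ω := Ω) hK).fintype
  obtain ⟨μ, hμ, h⟩ := exists_mixed_of_forall_exists_pure
    (fun (g : grid Ω K) (ω : Ω) => ∑ e, w e * payoff J K e (g, ω)) (1 / K * ∑ e, w e) (by
      intro q hq
      obtain ⟨g, hg, hqg⟩ := exists_mem_grid_abs_sub_le hK (⟨q, hq⟩ : Prediction Ω)
      refine ⟨⟨g, hg⟩, ?_⟩
      simp only [Finset.mul_sum]
      rw [Finset.sum_comm]
      refine Finset.sum_le_sum fun e _ => ?_
      have h1 := sum_mul_payoff_le J K e ⟨q, hq⟩ g (by positivity) hqg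
      calc ∑ ω, q ω * (w e * payoff J K e (g, ω)) = w e * ∑ ω, q ω * payoff J K e (g, ω) := by
            rw [Finset.mul_sum]
            exact Finset.sum_congr rfl fun ω _ => by ring
        _ ≤ w e * (1 / K) := mul_le_mul_of_nonneg_left h1 (hw e)
        _ = _ := mul_comm _ _)
  refine ⟨∑ g : grid Ω K, ENNReal.ofReal (μ g) • Measure.dirac (g : Prediction Ω), ⟨?_⟩, ?_, ?_⟩
  · rw [Measure.finsetSum_apply]
    simp only [Measure.smul_apply, measure_univ, smul_eq_mul, mul_one]
    rw [← ENNReal.ofReal_sum_of_nonneg fun g _ => hμ.1 g, hμ.2, ENNReal.ofReal_one]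
  · rw [ae_iff, Measure.finsetSum_apply]
    refine Finset.sum_eq_zero fun g _ => ?_
    simp
  · intro ω
    refine le_trans (le_of_eq ?_) (h ω)
    rw [integral_finsetSum_measure]
    · refine Finset.sum_congr rfl fun g _ => ?_
      rw [integral_smul_measure, integral_dirac, ENNReal.toReal_ofReal (hμ.1 g), smul_eq_mul]
    · intro g _
      refine Integrable.smul_measure (integrable_dirac ?_) ENNReal.ofReal_ne_top
      simp

/-- The solutions of a distance inequality in `{0, 1 / K, …, 1}` form an interval. -/
theorem exists_interval {K : ℕ} (hK : 0 < K) (x r : ℝ) : ∃ ab : Fin (K + 1) × Fin (K + 1),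
    ∀ c ≤ K, (|(c / K : ℝ) - x| ≤ r ↔ (ab.1 : ℕ) ≤ c ∧ c ≤ (ab.2 : ℕ)) := by
  classical
  have hK' : (0 : ℝ) < K := Nat.cast_pos.2 hK
  set S := (Finset.range (K + 1)).filter fun c : ℕ => |(c / K : ℝ) - x| ≤ r with hS
  have hmem : ∀ c, c ∈ S ↔ c < K + 1 ∧ |(c / K : ℝ) - x| ≤ r := fun c => by
    rw [hS, Finset.mem_filter, Finset.mem_range]
  by_cases hne : S.Nonempty
  · have ha := (hmem _).1 (S.min'_mem hne)
    have hb := (hmem _).1 (S.max'_mem hne)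
    refine ⟨(⟨_, ha.1⟩, ⟨_, hb.1⟩), fun c hc => ⟨fun h => ?_, fun h => ?_⟩⟩
    · have hcS : c ∈ S := (hmem c).2 ⟨Nat.lt_succ_of_le hc, h⟩
      exact ⟨S.min'_le c hcS, S.le_max' c hcS⟩
    · have h1 : ((S.min' hne : ℕ) / K : ℝ) ≤ c / K :=
        div_le_div_of_nonneg_right (Nat.cast_le.2 h.1) hK'.le
      have h2 : (c / K : ℝ) ≤ (S.max' hne : ℕ) / K :=
        div_le_div_of_nonneg_right (Nat.cast_le.2 h.2) hK'.le
      have h3 := abs_le.1 ha.2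
      have h4 := abs_le.1 hb.2
      exact abs_le.2 ⟨by linarith, by linarith⟩
  -- The pair `(1, 0)` encodes the empty interval; `1` is an admissible endpoint because `0 < K`.
  · refine ⟨(⟨1, by omega⟩, ⟨0, by omega⟩), fun c hc => ⟨fun h => ?_, fun h => ?_⟩⟩
    · exact (hne ⟨c, (hmem c).2 ⟨Nat.lt_succ_of_le hc, h⟩⟩).elim
    · exact absurd (h.1.trans h.2) (by simp)

/-- On the grid, every ball coincides with a box. -/
theorem exists_box (J : Finset Ω) {K : ℕ} (hK : 0 < K) {F : Set (Prediction Ω)}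
    (hF : F ∈ supBalls J) :
    ∃ b, ∀ g ∈ grid Ω K, g ∈ F ↔ g ∈ box J K b := by
  obtain ⟨p, r, hr, rfl⟩ := hF
  have hK' : (0 : ℝ) < K := Nat.cast_pos.2 hK
  choose b hb using fun i : J => exists_interval hK (p i) r
  refine ⟨b, ?_⟩
  rintro g ⟨c, hc⟩
  change ‖_‖ ≤ r ↔ _
  rw [pi_norm_le_iff_of_nonneg hr.le]
  refine forall_congr' fun i => ?_
  have h1 : g i ≤ 1 := stdSimplex.le_one g i
  rw [hc, div_le_one hK'] at h1
  have h2 := hb i (c i) (by exact_mod_cast h1)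
  change |g i - p i| ≤ r ↔ _
  rw [hc i, h2, div_le_div_iff_of_pos_right hK', div_le_div_iff_of_pos_right hK']
  norm_cast

/-! ### Scores as total errors. -/

/-- The total error over a set of predictions, in one coordinate. -/
noncomputable def totalError (F : Set (Prediction Ω)) (i : Ω) (n : ℕ) (h : ℕ → Stage Ω) : ℝ :=
  ∑ m ∈ Finset.range n, stageError F i (h m)

/-- The number of active stages cancels, leaving a sum over stages, to which the regret bound
applies. With no active stage both sides are zero. -/
theorem frequency_mul_gap (J : Finset Ω) (F : Set (Prediction Ω)) (n : ℕ) (h : ℕ → Stage Ω)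
    (i : J) : frequency F n h * gap J F n h i = totalError F i n h / n := by
  classical
  have h1 : totalError F i n h = ∑ m ∈ activeStages F n h,
      ((Pi.single (h m).2 (1 : ℝ) : Ω → ℝ) i - (h m).1 i) := by
    rw [activeStages, Finset.sum_filter, totalError]
    refine Finset.sum_congr rfl fun m _ => ?_
    simp only [stageError, Pi.single_apply]
    simp only [eq_comm]
  have h2 : gap J F n h i = ((activeStages F n h).card : ℝ)⁻¹ * totalError F i n h := by
    rw [h1, Finset.sum_sub_distrib, mul_sub]
    change empirical F n h i - avgPrediction F n h i = _
    simp only [empirical, avgPrediction, Pi.smul_apply, Finset.sum_apply, smul_eq_mul]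
  rw [h2, frequency]
  by_cases h0 : (activeStages F n h).card = 0
  · rw [Finset.card_eq_zero] at h0
    rw [h1, h0]
    simp
  · have : ((activeStages F n h).card : ℝ) ≠ 0 := Nat.cast_ne_zero.2 h0
    field_simp

theorem frequency_nonneg (F : Set (Prediction Ω)) (n : ℕ) (h : ℕ → Stage Ω) :
    0 ≤ frequency F n h := by
  unfold frequency
  positivity

theorem abs_totalError_le (F : Set (Prediction Ω)) (i : Ω) (n : ℕ) (h : ℕ → Stage Ω) :
    |totalError F i n h| ≤ n := by
  refine (Finset.abs_sum_le_sum_abs _ _).trans ?_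
  refine (Finset.sum_le_sum fun m _ => abs_stageError_le F i (h m)).trans ?_
  simp

theorem frequency_mul_norm_gap_le (J : Finset Ω) (F : Set (Prediction Ω)) (n : ℕ)
    (h : ℕ → Stage Ω) {C : ℝ} (hC : 0 ≤ C) (hle : ∀ i ∈ J, |totalError F i n h| / n ≤ C) :
    frequency F n h * ‖gap J F n h‖ ≤ C := by
  rw [← abs_of_nonneg (frequency_nonneg F n h), ← Real.norm_eq_abs, ← norm_smul,
    pi_norm_le_iff_of_nonneg hC]
  intro i
  rw [Pi.smul_apply, smul_eq_mul, frequency_mul_gap, Real.norm_eq_abs, abs_div, Nat.abs_cast]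
  exact hle i i.2

theorem abs_totalError_div_le_norm_gap (J : Finset Ω) (F : Set (Prediction Ω)) (n : ℕ)
    (h : ℕ → Stage Ω) {i : Ω} (hi : i ∈ J) :
    |totalError F i n h| / n ≤ frequency F n h * ‖gap J F n h‖ := by
  have h1 := frequency_mul_gap J F n h ⟨i, hi⟩
  have h2 := norm_le_pi_norm (gap J F n h) ⟨i, hi⟩
  calc |totalError F i n h| / n = |totalError F i n h / n| := by rw [abs_div, Nat.abs_cast]
    _ = frequency F n h * |gap J F n h ⟨i, hi⟩| := by
      rw [← h1, abs_mul, abs_of_nonneg (frequency_nonneg F n h)]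
    _ ≤ _ := mul_le_mul_of_nonneg_left h2 (frequency_nonneg F n h)

theorem frequency_mul_norm_gap_le_one (J : Finset Ω) (F : Set (Prediction Ω)) (n : ℕ)
    (h : ℕ → Stage Ω) : frequency F n h * ‖gap J F n h‖ ≤ 1 :=
  frequency_mul_norm_gap_le J F n h zero_le_one fun i _ =>
    div_le_one_of_le₀ (abs_totalError_le F i n h) (Nat.cast_nonneg n)

theorem nonempty_supBalls [Nonempty Ω] (J : Finset Ω) :
    Nonempty (supBalls J) := by
  classical
  exact ⟨⟨_, ⟨_, single_mem_stdSimplex ℝ (Classical.arbitrary Ω)⟩, 1, one_pos, rfl⟩⟩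

theorem bddAbove_score (J : Finset Ω) (𝓕 : Set (Set (Prediction Ω))) (n : ℕ) (h : ℕ → Stage Ω) :
    BddAbove (Set.range fun F : 𝓕 => frequency (F : Set (Prediction Ω)) n h * ‖gap J F n h‖) :=
  ⟨1, by rintro _ ⟨F, rfl⟩; exact frequency_mul_norm_gap_le_one J F n h⟩

theorem supScore_nonneg (J : Finset Ω) (𝓕 : Set (Set (Prediction Ω))) (n : ℕ)
    (h : ℕ → Stage Ω) : 0 ≤ supScore J 𝓕 n h := by
  unfold supScore
  refine Real.iSup_nonneg fun F => ?_
  exact mul_nonneg (frequency_nonneg _ n h) (norm_nonneg _)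

theorem supScore_le (J : Finset Ω) (𝓕 : Set (Set (Prediction Ω))) (n : ℕ) (h : ℕ → Stage Ω)
    {C : ℝ} (hC : 0 ≤ C) (hle : ∀ F ∈ 𝓕, ∀ i ∈ J, |totalError F i n h| / n ≤ C) :
    supScore J 𝓕 n h ≤ C :=
  Real.iSup_le (fun F => frequency_mul_norm_gap_le J F n h hC (hle F F.2)) hC

theorem supScore_le_one (J : Finset Ω) (𝓕 : Set (Set (Prediction Ω))) (n : ℕ)
    (h : ℕ → Stage Ω) : supScore J 𝓕 n h ≤ 1 :=
  Real.iSup_le (fun F => frequency_mul_norm_gap_le_one J F n h) zero_le_one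

theorem abs_totalError_le_supScore (J : Finset Ω) {𝓕 : Set (Set (Prediction Ω))} (n : ℕ)
    (h : ℕ → Stage Ω) {F : Set (Prediction Ω)} (hF : F ∈ 𝓕) {i : Ω} (hi : i ∈ J) :
    |totalError F i n h| ≤ n * supScore J 𝓕 n h := by
  rcases Nat.eq_zero_or_pos n with rfl | hn
  · simp [totalError]
  · have h1 := (abs_totalError_div_le_norm_gap J F n h hi).trans
      (le_ciSup (bddAbove_score J 𝓕 n h) ⟨F, hF⟩)
    rw [div_le_iff₀ (Nat.cast_pos.2 hn)] at h1
    rw [mul_comm]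
    exact h1

/-- Up to the factor `n`, the score changes by at most one at every stage. -/
theorem supScore_lipschitz (J : Finset Ω) (𝓕 : Set (Set (Prediction Ω))) (n : ℕ)
    (h : ℕ → Stage Ω) :
    n * supScore J 𝓕 n h ≤ (n + 1 : ℕ) * supScore J 𝓕 (n + 1) h + 1 := by
  rcases Nat.eq_zero_or_pos n with rfl | hn
  · have := supScore_nonneg J 𝓕 1 h
    simp only [Nat.cast_zero, zero_mul, zero_add, Nat.cast_one, one_mul]
    linarith
  have hn' : (0 : ℝ) < n := Nat.cast_pos.2 hn
  have h0 : 0 ≤ (n + 1 : ℕ) * supScore J 𝓕 (n + 1) h + 1 :=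
    add_nonneg (mul_nonneg (Nat.cast_nonneg _) (supScore_nonneg J 𝓕 _ h)) zero_le_one
  rw [mul_comm, ← le_div_iff₀ hn']
  refine supScore_le J 𝓕 n h (div_nonneg h0 hn'.le) fun F hF i hi => ?_
  refine div_le_div_of_nonneg_right ?_ hn'.le
  have h1 := abs_totalError_le_supScore J (n + 1) h hF hi
  have h2 : totalError F i (n + 1) h = totalError F i n h + stageError F i (h n) :=
    Finset.sum_range_succ _ _
  have h3 := abs_stageError_le F i (h n)
  rw [abs_le] at h1 h3 ⊢
  constructor <;> linarith

theorem euclideanScore_nonneg (J : Finset Ω) (𝓕 : Set (Set (Prediction Ω))) (n : ℕ)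
    (h : ℕ → Stage Ω) : 0 ≤ euclideanScore J 𝓕 n h := by
  unfold euclideanScore
  refine Real.iSup_nonneg fun F => ?_
  exact mul_nonneg (frequency_nonneg _ n h) (norm_nonneg _)

theorem euclideanScore_le (J : Finset Ω) (𝓕 : Set (Set (Prediction Ω))) (n : ℕ)
    (h : ℕ → Stage Ω) : euclideanScore J 𝓕 n h ≤ √J.card * supScore J 𝓕 n h := by
  unfold euclideanScore
  refine Real.iSup_le (fun F => ?_)
    (mul_nonneg (Real.sqrt_nonneg _) (supScore_nonneg J 𝓕 n h))
  have h1 : ‖(WithLp.toLp 2 (gap J F n h) : EuclideanSpace ℝ J)‖ ≤ √J.card * ‖gap J F n h‖ := by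
    rw [EuclideanSpace.norm_eq, ← Real.sqrt_sq (norm_nonneg (gap J F n h)),
      ← Real.sqrt_mul (Nat.cast_nonneg _)]
    refine Real.sqrt_le_sqrt ?_
    calc ∑ i, ‖gap J F n h i‖ ^ 2 ≤ ∑ _i : J, ‖gap J F n h‖ ^ 2 :=
          Finset.sum_le_sum fun i _ =>
            pow_le_pow_left₀ (norm_nonneg _) (norm_le_pi_norm (gap J F n h) i) 2
      _ = _ := by simp
  have h2 := mul_le_mul_of_nonneg_left h1 (frequency_nonneg F n h)
  have h3 : frequency F n h * ‖gap J F n h‖ ≤ supScore J 𝓕 n h := le_ciSup (bddAbove_score J 𝓕 n h) F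
  have h4 := mul_le_mul_of_nonneg_left h3 (Real.sqrt_nonneg J.card)
  refine h2.trans (le_trans (le_of_eq ?_) h4)
  rw [mul_left_comm]

end Experts

/-! ### One-stage estimates under the law of the play. -/

section PlayLaw

variable {Ω : Type*} [Fintype Ω] [MeasurableSpace Ω]

instance (σ : Strategy Ω (Prediction Ω)) (τ : Strategy Ω Ω) :
    IsProbabilityMeasure (playLaw σ τ) := by
  unfold playLaw
  infer_instance

theorem map_eval_zero_playLaw (σ : Strategy Ω (Prediction Ω)) (τ : Strategy Ω Ω) :
    (playLaw σ τ).map (fun h => h 0) = σ.first.prod τ.first := by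
  have h1 : (fun h : ℕ → Stage Ω => h 0) =
      (MeasurableEquiv.piUnique fun _ : Finset.Iic 0 => Stage Ω) ∘
        Preorder.frestrictLe (π := fun _ => Stage Ω) 0 := rfl
  have h2 := Measure.map_map (μ := playLaw σ τ)
    (MeasurableEquiv.piUnique fun _ : Finset.Iic 0 => Stage Ω).measurable
    (Preorder.measurable_frestrictLe (X := fun _ => Stage Ω) 0)
  rw [h1, ← h2,
    playLaw, Kernel.trajMeasure, Measure.map_comp _ _ (by fun_prop), Kernel.traj_map_frestrictLe,
    Kernel.partialTraj_self, Measure.id_comp]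
  exact MeasurableEquiv.map_map_symm _

theorem map_frestrictLe_succ_playLaw (σ : Strategy Ω (Prediction Ω)) (τ : Strategy Ω Ω) (n : ℕ) :
    (playLaw σ τ).map (fun h => (Preorder.frestrictLe (π := fun _ => Stage Ω) n h, h (n + 1))) =
      (playLaw σ τ).map (Preorder.frestrictLe (π := fun _ => Stage Ω) n) ⊗ₘ
        ((σ.next n).prod (τ.next n)) :=
  Kernel.map_frestrictLe_trajMeasure_compProd_eq_map_trajMeasure.symm

/-- Independence within a stage enters here: the prediction can be integrated first, with the state
frozen, so a bound uniform in the state survives any law of Nature. -/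
theorem integral_prod_le {A B : Type*} [MeasurableSpace A] [MeasurableSpace B] (μ : Measure A)
    (ν : Measure B) [IsProbabilityMeasure μ] [IsProbabilityMeasure ν] {f : A × B → ℝ}
    (hf : Integrable f (μ.prod ν)) {ε : ℝ} (hε : ∀ b, ∫ a, f (a, b) ∂μ ≤ ε) :
    ∫ x, f x ∂(μ.prod ν) ≤ ε := by
  rw [integral_prod_symm f hf]
  calc ∫ b, ∫ a, f (a, b) ∂μ ∂ν ≤ ∫ _, ε ∂ν :=
        integral_mono hf.integral_prod_right (integrable_const _) hε
    _ = ε := by simp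

theorem integral_stage_zero_le (σ : Strategy Ω (Prediction Ω)) (τ : Strategy Ω Ω)
    {f : Stage Ω → ℝ} (hf : Measurable f) {C : ℝ} (hC : ∀ s, |f s| ≤ C) {ε : ℝ}
    (hε : ∀ ω, ∫ p, f (p, ω) ∂σ.first ≤ ε) :
    ∫ h, f (h 0) ∂(playLaw σ τ) ≤ ε := by
  rw [← integral_map (φ := fun h : ℕ → Stage Ω => h 0) (measurable_pi_apply 0).aemeasurable
    hf.aestronglyMeasurable, map_eval_zero_playLaw]
  exact integral_prod_le _ _ (Integrable.of_bound hf.aestronglyMeasurable C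
    (Eventually.of_forall hC)) hε

/-- Disintegrating over the history reduces the claim to the product of two one-stage laws, where
`integral_prod_le` applies. -/
theorem integral_stage_succ_le (σ : Strategy Ω (Prediction Ω)) (τ : Strategy Ω Ω) (n : ℕ)
    {f : ((_ : Finset.Iic n) → Stage Ω) × Stage Ω → ℝ} (hf : Measurable f) {C : ℝ}
    (hC : ∀ s, |f s| ≤ C) {ε : ℝ} (hε : ∀ h ω, ∫ p, f (h, p, ω) ∂(σ.next n h) ≤ ε) :
    ∫ h, f (Preorder.frestrictLe (π := fun _ => Stage Ω) n h, h (n + 1)) ∂(playLaw σ τ) ≤ ε := by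
  have hm : Measurable (Preorder.frestrictLe (π := fun _ => Stage Ω) n) :=
    Preorder.measurable_frestrictLe n
  have := Measure.isProbabilityMeasure_map (μ := playLaw σ τ) hm.aemeasurable
  rw [← integral_map (φ := fun h : ℕ → Stage Ω =>
    (Preorder.frestrictLe (π := fun _ => Stage Ω) n h, h (n + 1))) (by fun_prop)
    hf.aestronglyMeasurable, map_frestrictLe_succ_playLaw]
  have hint := Integrable.of_bound (μ := (playLaw σ τ).map
    (Preorder.frestrictLe (π := fun _ => Stage Ω) n) ⊗ₘ ((σ.next n).prod (τ.next n)))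
    hf.aestronglyMeasurable C (Eventually.of_forall hC)
  rw [Measure.integral_compProd hint]
  calc _ ≤ ∫ _, ε ∂((playLaw σ τ).map (Preorder.frestrictLe (π := fun _ => Stage Ω) n)) := by
        refine integral_mono ?_ (integrable_const _) fun h => ?_
        · exact Integrable.integral_compProd (a := ()) (κ := Kernel.const Unit _)
            (η := Kernel.prodMkLeft Unit _) hint
        dsimp only
        rw [Kernel.prod_apply]
        exact integral_prod_le _ _ (Integrable.of_bound
          (hf.comp measurable_prodMk_left).aestronglyMeasurable C
          (Eventually.of_forall fun _ => hC _)) (hε h)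
    _ = ε := by simp

theorem ae_stage_zero_mem (σ : Strategy Ω (Prediction Ω)) (τ : Strategy Ω Ω)
    {G : Set (Prediction Ω)} (hG : MeasurableSet G) (h0 : ∀ᵐ p ∂σ.first, p ∈ G) :
    ∀ᵐ h ∂(playLaw σ τ), (h 0).1 ∈ G := by
  have h1 : ∀ᵐ s ∂(σ.first.prod τ.first), s.1 ∈ G := Measure.quasiMeasurePreserving_fst.ae h0
  rw [← map_eval_zero_playLaw σ τ, ae_map_iff (measurable_pi_apply (X := fun _ => Stage Ω) 0).aemeasurable
    (measurable_fst hG)] at h1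
  exact h1

theorem ae_stage_succ_mem (σ : Strategy Ω (Prediction Ω)) (τ : Strategy Ω Ω) (n : ℕ)
    {G : Set (Prediction Ω)} (hG : MeasurableSet G) (h0 : ∀ h, ∀ᵐ p ∂(σ.next n h), p ∈ G) :
    ∀ᵐ h ∂(playLaw σ τ), (h (n + 1)).1 ∈ G := by
  have hs : MeasurableSet {x : ((_ : Finset.Iic n) → Stage Ω) × Stage Ω | x.2.1 ∈ G} :=
    (measurable_fst.comp measurable_snd) hG
  have h1 : ∀ᵐ x ∂((playLaw σ τ).map (Preorder.frestrictLe (π := fun _ => Stage Ω) n) ⊗ₘ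
      ((σ.next n).prod (τ.next n))), x.2.1 ∈ G := by
    refine Measure.ae_compProd_of_ae_ae hs (Eventually.of_forall fun h => ?_)
    rw [Kernel.prod_apply]
    exact Measure.quasiMeasurePreserving_fst.ae (h0 h)
  rw [← map_frestrictLe_succ_playLaw σ τ, ae_map_iff (by fun_prop) hs] at h1
  exact h1

end PlayLaw

/-! ### Countable coding of grid histories, used for measurability. -/

section Coding

variable {Ω : Type*} [Fintype Ω]

/-- A countable code for the observation of one stage. -/
noncomputable def code (K : ℕ) (s : Stage Ω) : (Ω → ℕ) × Ω := (fun i => ⌊K * s.1 i⌋₊, s.2)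

open Classical in
/-- The observation with a given code, if it is on the grid. -/
noncomputable def decode [Nonempty Ω] (K : ℕ) (c : (Ω → ℕ) × Ω) : Stage Ω :=
  (if h : (fun i => (c.1 i / K : ℝ)) ∈ stdSimplex ℝ Ω then ⟨_, h⟩ else
    Classical.arbitrary _, c.2)

/-- On the grid the numbers `K * p i` are integers, so taking floors loses nothing. -/
theorem decode_code [Nonempty Ω] {K : ℕ} (hK : 0 < K) {s : Stage Ω} (hs : s.1 ∈ grid Ω K) :
    decode K (code K s) = s := by
  obtain ⟨p, ω⟩ := s
  obtain ⟨c, hc⟩ := hs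
  have hK' : (K : ℝ) ≠ 0 := Nat.cast_ne_zero.2 hK.ne'
  have h1 : (fun i => ((code K (p, ω)).1 i / K : ℝ)) = p := by
    funext i
    simp only [code]
    have h2 : p i = c i / K := hc i
    rw [h2, mul_div_cancel₀ _ hK', Nat.floor_natCast]
  have h3 : (fun i => ((code K (p, ω)).1 i / K : ℝ)) ∈ stdSimplex ℝ Ω := by
    rw [h1]
    exact p.2
  unfold decode
  rw [dif_pos h3]
  exact Prod.ext (Subtype.ext h1) rfl

theorem measurable_code [MeasurableSpace Ω] (K : ℕ) : Measurable (code (Ω := Ω) K) := by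
  refine Measurable.prodMk (measurable_pi_lambda _ fun i => ?_) measurable_snd
  have : Measurable fun s : Stage Ω => s.1 i :=
    (measurable_pi_apply i).comp (measurable_subtype_coe.comp measurable_fst)
  exact Nat.measurable_floor.comp (this.const_mul _)

end Coding

/-! ### The strategy and its mean payoff. -/

/-- The parameters of the strategy: the stages are partitioned into colours, and every colour
has its own grid and its own learning rate. -/
structure Schedule where
  colour : ℕ → ℕ
  mesh : ℕ → ℕ
  rate : ℕ → ℝ
  mesh_pos : ∀ j, 0 < mesh j
  rate_pos : ∀ j, 0 < rate j
  rate_le_one : ∀ j, rate j ≤ 1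

section Strategy

variable {Ω : Type*} [Fintype Ω]

/-- The weights of the experts at stage `n`. -/
noncomputable def weights (S : Schedule) (J : Finset Ω) (n : ℕ) (h : ℕ → Stage Ω)
    (e : Expert J (S.mesh (S.colour n))) : ℝ :=
  Real.exp (S.rate (S.colour n) *
    cumulative S.colour (S.colour n) (fun l e => payoff J (S.mesh (S.colour n)) e (h l)) n e)

theorem weights_nonneg (S : Schedule) (J : Finset Ω) (n : ℕ) (h : ℕ → Stage Ω)
    (e : Expert J (S.mesh (S.colour n))) : 0 ≤ weights S J n h e := (Real.exp_pos _).le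

/-- Learning restarts with each colour: only earlier stages of the current colour are read. Hence
decoding a history with the current mesh is harmless even if other stages lie on other grids. -/
theorem weights_congr (S : Schedule) (J : Finset Ω) {n : ℕ} {h h' : ℕ → Stage Ω}
    (H : ∀ l < n, S.colour l = S.colour n → h l = h' l) : weights S J n h = weights S J n h' := by
  funext e
  unfold weights cumulative
  congr 2
  refine Finset.sum_congr rfl fun l hl => ?_
  rw [Finset.mem_filter, Finset.mem_range] at hl
  dsimp only
  rw [H l hl.1 hl.2]

/-- The weighted average of the payoffs of the experts. -/
noncomputable def weightedPayoff (J : Finset Ω) (K : ℕ) (w : Expert J K → ℝ) (s : Stage Ω) : ℝ :=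
  (∑ e, w e * payoff J K e s) / ∑ e, w e

theorem abs_weightedPayoff_le (J : Finset Ω) (K : ℕ) {w : Expert J K → ℝ} (hw : ∀ e, 0 ≤ w e)
    (s : Stage Ω) : |weightedPayoff J K w s| ≤ 1 := by
  have hW : 0 ≤ ∑ e, w e := Finset.sum_nonneg fun e _ => hw e
  rw [weightedPayoff, abs_div, abs_of_nonneg hW]
  refine div_le_one_of_le₀ ((Finset.abs_sum_le_sum_abs _ _).trans ?_) hW
  refine Finset.sum_le_sum fun e _ => ?_
  rw [abs_mul, abs_of_nonneg (hw e)]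
  exact mul_le_of_le_one_right (hw e) (abs_payoff_le J K e s)

/-- The average payoff of the experts at stage `n`. -/
noncomputable def stageMean (S : Schedule) (J : Finset Ω) (n : ℕ) (h : ℕ → Stage Ω) : ℝ :=
  weightedPayoff J _ (weights S J n h) (h n)

theorem abs_stageMean_le (S : Schedule) (J : Finset Ω) (n : ℕ) (h : ℕ → Stage Ω) :
    |stageMean S J n h| ≤ 1 :=
  abs_weightedPayoff_le J _ (weights_nonneg S J n h) _

section Measurability

variable [MeasurableSpace Ω] [DiscreteMeasurableSpace Ω]

theorem measurable_weightedPayoff {A : Type*} [MeasurableSpace A] (J : Finset Ω) (K : ℕ)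
    {w : A → Expert J K → ℝ} (hw : Measurable w) {s : A → Stage Ω} (hs : Measurable s) :
    Measurable fun a => weightedPayoff J K (w a) (s a) := by
  have hwe : ∀ e, Measurable fun a => w a e := fun e => (measurable_pi_apply e).comp hw
  exact (Finset.measurable_sum _ fun e _ =>
    (hwe e).mul ((measurable_payoff J K e).comp hs)).div (Finset.measurable_sum _ fun e _ => hwe e)

theorem measurable_weights (S : Schedule) (J : Finset Ω) (n : ℕ) :
    Measurable (weights S J n) := by
  refine measurable_pi_lambda _ fun e => Real.measurable_exp.comp (Measurable.const_mul ?_ _)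
  exact Finset.measurable_sum _ fun l _ => (measurable_payoff J _ e).comp (measurable_pi_apply l)

theorem measurable_stageMean (S : Schedule) (J : Finset Ω) (n : ℕ) :
    Measurable (stageMean S J n) :=
  measurable_weightedPayoff J _ (measurable_weights S J n) (measurable_pi_apply n)

theorem integrable_stageMean (S : Schedule) (J : Finset Ω) (n : ℕ)
    (σ : Strategy Ω (Prediction Ω)) (τ : Strategy Ω Ω) :
    Integrable (stageMean S J n) (playLaw σ τ) :=
  Integrable.of_bound (measurable_stageMean S J n).aestronglyMeasurable 1
    (Eventually.of_forall fun h => abs_stageMean_le S J n h)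

end Measurability

/-- The history of the stages up to `n`, extended arbitrarily. -/
noncomputable def extend [Nonempty Ω] (n : ℕ) (h : (_ : Finset.Iic n) → Stage Ω) : ℕ → Stage Ω :=
  fun l => if hl : l ∈ Finset.Iic n then h ⟨l, hl⟩ else
    ⟨Classical.arbitrary _, Classical.arbitrary _⟩

variable [Nonempty Ω]

/-- The law of the prediction at stage `n`. -/
noncomputable def predictionLaw (S : Schedule) (J : Finset Ω) (n : ℕ) (h : ℕ → Stage Ω) :
    Measure (Prediction Ω) :=
  (exists_law J (S.mesh_pos (S.colour n)) (weights S J n h) (weights_nonneg S J n h)).choose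

instance (S : Schedule) (J : Finset Ω) (n : ℕ) (h : ℕ → Stage Ω) :
    IsProbabilityMeasure (predictionLaw S J n h) :=
  (exists_law J (S.mesh_pos (S.colour n)) (weights S J n h)
    (weights_nonneg S J n h)).choose_spec.1

theorem ae_predictionLaw (S : Schedule) (J : Finset Ω) (n : ℕ) (h : ℕ → Stage Ω) :
    ∀ᵐ p ∂(predictionLaw S J n h), p ∈ grid Ω (S.mesh (S.colour n)) :=
  (exists_law J (S.mesh_pos (S.colour n)) (weights S J n h)
    (weights_nonneg S J n h)).choose_spec.2.1

theorem integral_predictionLaw_le (S : Schedule) (J : Finset Ω) (n : ℕ) (h : ℕ → Stage Ω) (ω : Ω) :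
    ∫ p, weightedPayoff J _ (weights S J n h) (p, ω) ∂(predictionLaw S J n h) ≤
      1 / S.mesh (S.colour n) := by
  unfold weightedPayoff
  rw [integral_div]
  exact div_le_of_le_mul₀ (Finset.sum_nonneg fun e _ => weights_nonneg S J n h e) (by positivity)
    ((exists_law J (S.mesh_pos (S.colour n)) (weights S J n h)
      (weights_nonneg S J n h)).choose_spec.2.2 ω)

variable [MeasurableSpace Ω] [DiscreteMeasurableSpace Ω]

/-- The calibrated strategy. -/
noncomputable def calibratedStrategy (S : Schedule) (J : Finset Ω) :
    Strategy Ω (Prediction Ω) where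
  first := predictionLaw S J 0 fun _ => ⟨Classical.arbitrary _, Classical.arbitrary _⟩
  -- `predictionLaw` is obtained by choice, with no measurability in the history. Factoring it
  -- through a countable code makes measurability automatic.
  next n := (Kernel.ofFunOfCountable fun c : (_ : Finset.Iic n) → (Ω → ℕ) × Ω =>
    predictionLaw S J (n + 1)
      (extend n fun l => decode (S.mesh (S.colour (n + 1))) (c l))).comap
    (fun h l => code (S.mesh (S.colour (n + 1))) (h l))
    (measurable_pi_lambda _ fun l => (measurable_code _).comp (measurable_pi_apply l))
  isProbabilityMeasure_first := inferInstance
  isMarkovKernel_next n := by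
    refine ⟨fun h => ?_⟩
    rw [Kernel.comap_apply]
    exact inferInstanceAs (IsProbabilityMeasure (predictionLaw S J (n + 1) _))

theorem calibratedStrategy_next (S : Schedule) (J : Finset Ω) (n : ℕ)
    (h : (_ : Finset.Iic n) → Stage Ω) : (calibratedStrategy S J).next n h =
      predictionLaw S J (n + 1) (extend n fun l => decode (S.mesh (S.colour (n + 1)))
        (code (S.mesh (S.colour (n + 1))) (h l))) := rfl

theorem ae_mem_grid (S : Schedule) (J : Finset Ω) (τ : Strategy Ω Ω) :
    ∀ᵐ h ∂(playLaw (calibratedStrategy S J) τ), ∀ m, (h m).1 ∈ grid Ω (S.mesh (S.colour m)) := by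
  rw [ae_all_iff]
  rintro (_ | n)
  · exact ae_stage_zero_mem _ τ (grid_finite (S.mesh_pos _)).measurableSet
      (ae_predictionLaw S J 0 _)
  · exact ae_stage_succ_mem _ τ n (grid_finite (S.mesh_pos _)).measurableSet fun h => by
      rw [calibratedStrategy_next]
      exact ae_predictionLaw S J (n + 1) _

theorem integral_stageMean_le (S : Schedule) (J : Finset Ω) (τ : Strategy Ω Ω) (m : ℕ) :
    ∫ h, stageMean S J m h ∂(playLaw (calibratedStrategy S J) τ) ≤ 1 / S.mesh (S.colour m) := by
  rcases m with _ | n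
  · set h₀ : ℕ → Stage Ω := fun _ => ⟨Classical.arbitrary _, Classical.arbitrary _⟩
    have h1 : ∀ h, stageMean S J 0 h = weightedPayoff J _ (weights S J 0 h₀) (h 0) := fun h => by
      rw [stageMean, weights_congr S J (h := h) (h' := h₀) fun l hl => absurd hl (Nat.not_lt_zero l)]
    simp only [h1]
    exact integral_stage_zero_le _ τ
      (measurable_weightedPayoff J _ measurable_const measurable_id)
      (abs_weightedPayoff_le J _ (weights_nonneg S J 0 h₀)) (integral_predictionLaw_le S J 0 h₀)
  · set K := S.mesh (S.colour (n + 1)) with hK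
    set W : ((_ : Finset.Iic n) → Stage Ω) → Expert J K → ℝ := fun h =>
      weights S J (n + 1) (extend n fun l => decode K (code K (h l))) with hW
    have hWm : Measurable W := by
      have h1 : Measurable fun c : (_ : Finset.Iic n) → (Ω → ℕ) × Ω =>
        weights S J (n + 1) (extend n fun l => decode K (c l)) := measurable_of_countable _
      exact h1.comp (measurable_pi_lambda _ fun l => (measurable_code _).comp
        (measurable_pi_apply l))
    -- Almost surely the past stages of the current colour lie on the current grid and are decoded
    -- correctly; the weights ignore the others.
    have h1 : (fun h => stageMean S J (n + 1) h) =ᵐ[playLaw (calibratedStrategy S J) τ] fun h =>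
        weightedPayoff J K (W (Preorder.frestrictLe (π := fun _ => Stage Ω) n h))
          (h (n + 1)) := by
      filter_upwards [ae_mem_grid S J τ] with h hh
      rw [stageMean, hW]
      dsimp only
      congr 1
      refine weights_congr S J fun l hl hc => ?_
      have hl' : l ∈ Finset.Iic n := Finset.mem_Iic.2 (Nat.lt_succ_iff.1 hl)
      have h2 := hh l
      rw [hc] at h2
      rw [extend, dif_pos hl']
      exact (decode_code (S.mesh_pos _) h2).symm
    rw [integral_congr_ae h1]
    refine integral_stage_succ_le (calibratedStrategy S J) τ n
      (f := fun x => weightedPayoff J K (W x.1) x.2)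
      (measurable_weightedPayoff J K (hWm.comp measurable_fst) measurable_snd)
      (fun s => abs_weightedPayoff_le J K (weights_nonneg S J (n + 1) _) _) fun h ω => ?_
    rw [calibratedStrategy_next]
    exact integral_predictionLaw_le S J (n + 1) _ ω

end Strategy

/-! ### The score bound for an arbitrary schedule. -/

section Bound

variable {Ω : Type*} [Fintype Ω]

theorem totalError_congr (F : Set (Prediction Ω)) (i : Ω) {n : ℕ} {h h' : ℕ → Stage Ω}
    (H : ∀ l < n, h l = h' l) : totalError F i n h = totalError F i n h' :=
  Finset.sum_congr rfl fun l hl => by rw [H l (Finset.mem_range.1 hl)]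

theorem supScore_congr (J : Finset Ω) (𝓕 : Set (Set (Prediction Ω))) {n : ℕ} {h h' : ℕ → Stage Ω}
    (H : ∀ l < n, h l = h' l) : supScore J 𝓕 n h = supScore J 𝓕 n h' := by
  unfold supScore
  refine iSup_congr fun F => ?_
  rw [← abs_of_nonneg (frequency_nonneg (F : Set (Prediction Ω)) n h),
    ← abs_of_nonneg (frequency_nonneg (F : Set (Prediction Ω)) n h'), ← Real.norm_eq_abs,
    ← Real.norm_eq_abs, ← norm_smul, ← norm_smul]
  congr 1
  funext i
  rw [Pi.smul_apply, Pi.smul_apply, smul_eq_mul, smul_eq_mul, frequency_mul_gap,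
    frequency_mul_gap, totalError_congr (F : Set (Prediction Ω)) (i : Ω) H]

/-- The regret term of one colour. -/
theorem abs_sum_stageError_le (S : Schedule) (J : Finset Ω) {h : ℕ → Stage Ω}
    (hh : ∀ m, (h m).1 ∈ grid Ω (S.mesh (S.colour m))) {F : Set (Prediction Ω)}
    (hF : F ∈ supBalls J) {i : Ω} (hi : i ∈ J) (n j : ℕ) :
    |∑ m ∈ Finset.range n with S.colour m = j, stageError F i (h m)| ≤
      Real.log (Fintype.card (Expert J (S.mesh j))) / S.rate j +
        ∑ m ∈ Finset.range n with S.colour m = j, (S.rate (S.colour m) + stageMean S J m h) := by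
  obtain ⟨b, hb⟩ := exists_box J (S.mesh_pos j) hF
  have h1 : ∀ m, S.colour m = j → stageError F i (h m) = stageError (box J (S.mesh j) b) i (h m) := by
    intro m hm
    have h2 := hb (h m).1 (hm ▸ hh m)
    by_cases h5 : (h m).1 ∈ F
    · simp [stageError, h5, h2.1 h5]
    · simp [stageError, h5, h2.not.1 h5]
  have h3 : ∑ m ∈ Finset.range n with S.colour m = j, stageError F i (h m) =
      ∑ m ∈ Finset.range n with S.colour m = j, stageError (box J (S.mesh j) b) i (h m) :=
    Finset.sum_congr rfl fun m hm => h1 m (Finset.mem_filter.1 hm).2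
  have h4 : ∑ m ∈ Finset.range n with S.colour m = j, (S.rate (S.colour m) + stageMean S J m h) =
      ∑ m ∈ Finset.range n with S.colour m = j, (S.rate j +
        meanPayoff S.colour j (S.rate j) (fun l e => payoff J (S.mesh j) e (h l)) m) := by
    refine Finset.sum_congr rfl fun m hm => ?_
    obtain rfl := (Finset.mem_filter.1 hm).2
    rfl
  -- The experts with the two opposite signs bound the error from above and from below.
  have key := fun s : Bool => cumulative_le S.colour j (S.rate_pos j) (S.rate_le_one j)
    (fun l e => payoff J (S.mesh j) e (h l)) (fun l e => abs_payoff_le J _ e (h l)) n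
    (b, ⟨i, hi⟩, s)
  have kt := key true
  have kf := key false
  have et : cumulative S.colour j (fun l e => payoff J (S.mesh j) e (h l)) n (b, ⟨i, hi⟩, true) =
      ∑ m ∈ Finset.range n with S.colour m = j, stageError (box J (S.mesh j) b) i (h m) := by
    simp [cumulative, payoff]
  have ef : cumulative S.colour j (fun l e => payoff J (S.mesh j) e (h l)) n (b, ⟨i, hi⟩, false) =
      -∑ m ∈ Finset.range n with S.colour m = j, stageError (box J (S.mesh j) b) i (h m) := by
    simp [cumulative, payoff]
  rw [et] at kt
  rw [ef] at kf
  rw [h3, h4, abs_le]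
  exact ⟨by linarith, by linarith⟩

/-- The pathwise bound on the errors of the calibrated strategy. -/
theorem abs_totalError_le_of_mem_grid (S : Schedule) (J : Finset Ω) {h : ℕ → Stage Ω}
    (hh : ∀ m, (h m).1 ∈ grid Ω (S.mesh (S.colour m))) {F : Set (Prediction Ω)}
    (hF : F ∈ supBalls J) {i : Ω} (hi : i ∈ J) {n N : ℕ} (hN : ∀ m < n, S.colour m < N) :
    |totalError F i n h| ≤
      ∑ j ∈ Finset.range N, Real.log (Fintype.card (Expert J (S.mesh j))) / S.rate j +
        ∑ m ∈ Finset.range n, (S.rate (S.colour m) + stageMean S J m h) := by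
  have hmaps : ∀ m ∈ Finset.range n, S.colour m ∈ Finset.range N := fun m hm =>
    Finset.mem_range.2 (hN m (Finset.mem_range.1 hm))
  rw [totalError, ← Finset.sum_fiberwise_of_maps_to hmaps,
    ← Finset.sum_fiberwise_of_maps_to hmaps (fun m => S.rate (S.colour m) + stageMean S J m h),
    ← Finset.sum_add_distrib]
  exact (Finset.abs_sum_le_sum_abs _ _).trans
    (Finset.sum_le_sum fun j _ => abs_sum_stageError_le S J hh hF hi n j)

variable [Nonempty Ω] [MeasurableSpace Ω] [DiscreteMeasurableSpace Ω]

/-- The supremum runs over an uncountable family, but almost surely the score is a function of the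
countable code of a finite history, each stage being coded with its own mesh. -/
theorem integrable_supScore (S : Schedule) (J : Finset Ω) (τ : Strategy Ω Ω)
    (𝓕 : Set (Set (Prediction Ω))) (n : ℕ) :
    Integrable (fun h => supScore J 𝓕 n h) (playLaw (calibratedStrategy S J) τ) := by
  set φ : ((_ : Finset.Iic n) → (Ω → ℕ) × Ω) → ℝ := fun c =>
    supScore J 𝓕 n (extend n fun l => decode (S.mesh (S.colour l)) (c l)) with hφ
  have hm : Measurable fun h : ℕ → Stage Ω =>
      φ fun l => code (S.mesh (S.colour l)) (h l) :=
    (measurable_of_countable φ).comp (measurable_pi_lambda _ fun l =>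
      (measurable_code _).comp (measurable_pi_apply _))
  refine Integrable.of_bound ⟨_, hm.stronglyMeasurable, ?_⟩ 1 (Eventually.of_forall fun h => ?_)
  · filter_upwards [ae_mem_grid S J τ] with h hh
    refine supScore_congr J 𝓕 fun l hl => ?_
    rw [extend, dif_pos (Finset.mem_Iic.2 hl.le)]
    exact (decode_code (S.mesh_pos _) (hh l)).symm
  · rw [Real.norm_eq_abs, abs_of_nonneg (supScore_nonneg J 𝓕 n h)]
    exact supScore_le_one J 𝓕 n h

/-- The pathwise regret bound is uniform over balls and coordinates, so it already dominates the
supremum; only the mean payoffs remain to be integrated. -/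
theorem integral_supScore_le (S : Schedule) (J : Finset Ω) (τ : Strategy Ω Ω) {n N : ℕ}
    (hN : ∀ m < n, S.colour m < N) :
    ∫ h, supScore J (supBalls J) n h ∂(playLaw (calibratedStrategy S J) τ) ≤
      (∑ j ∈ Finset.range N, Real.log (Fintype.card (Expert J (S.mesh j))) / S.rate j +
        ∑ m ∈ Finset.range n, (S.rate (S.colour m) + 1 / S.mesh (S.colour m))) / n := by
  have hlog : 0 ≤ ∑ j ∈ Finset.range N,
      Real.log (Fintype.card (Expert J (S.mesh j))) / S.rate j :=
    Finset.sum_nonneg fun j _ => div_nonneg (Real.log_natCast_nonneg _) (S.rate_pos j).le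
  -- A coordinate `i₀` is needed below to see that the pathwise bound is nonnegative; if there is
  -- none, the score is zero.
  rcases J.eq_empty_or_nonempty with hJ | ⟨i₀, hi₀⟩
  · have h0 : ∀ h, supScore J (supBalls J) n h = 0 := fun h =>
      le_antisymm (supScore_le J _ n h le_rfl fun F _ i hi => by simp [hJ] at hi)
        (supScore_nonneg J _ n h)
    simp only [h0, integral_zero]
    refine div_nonneg (add_nonneg hlog (Finset.sum_nonneg fun m _ =>
      add_nonneg (S.rate_pos _).le (by positivity))) (Nat.cast_nonneg n)
  set A := ∑ j ∈ Finset.range N, Real.log (Fintype.card (Expert J (S.mesh j))) / S.rate j with hA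
  set P := playLaw (calibratedStrategy S J) τ with hP
  have hterm : ∀ m, Integrable (fun h => S.rate (S.colour m) + stageMean S J m h) P := fun m =>
    (integrable_const _).add (integrable_stageMean S J m _ τ)
  have hsum : Integrable (fun h => ∑ m ∈ Finset.range n,
      (S.rate (S.colour m) + stageMean S J m h)) P := integrable_finsetSum _ fun m _ => hterm m
  have hint : Integrable (fun h => (A + ∑ m ∈ Finset.range n,
      (S.rate (S.colour m) + stageMean S J m h)) / n) P :=
    ((integrable_const _).add hsum).div_const _
  calc ∫ h, supScore J (supBalls J) n h ∂P
      ≤ ∫ h, (A + ∑ m ∈ Finset.range n, (S.rate (S.colour m) + stageMean S J m h)) / n ∂P := by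
        refine integral_mono_ae (integrable_supScore S J τ _ n) hint ?_
        filter_upwards [ae_mem_grid S J τ] with h hh
        obtain ⟨F₀⟩ := nonempty_supBalls J
        refine supScore_le J _ n h (div_nonneg ((abs_nonneg _).trans
          (abs_totalError_le_of_mem_grid S J hh F₀.2 hi₀ hN)) (Nat.cast_nonneg n))
          fun F hF i hi => div_le_div_of_nonneg_right
            (abs_totalError_le_of_mem_grid S J hh hF hi hN) (Nat.cast_nonneg n)
    _ = (A + ∑ m ∈ Finset.range n, (S.rate (S.colour m) + ∫ h, stageMean S J m h ∂P)) / n := by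
        rw [integral_div, integral_add (integrable_const _) hsum,
          integral_finsetSum _ fun m _ => hterm m]
        congr 2
        · simp
        · refine Finset.sum_congr rfl fun m _ => ?_
          rw [integral_add (integrable_const _) (integrable_stageMean S J m _ τ)]
          simp [hP]
    _ ≤ _ := div_le_div_of_nonneg_right (add_le_add le_rfl (Finset.sum_le_sum fun m _ =>
        add_le_add le_rfl (integral_stageMean_le S J τ m))) (Nat.cast_nonneg n)

end Bound

/-! ### The geometric schedule and the explicit constant. -/

section Schedule

/-- The schedule with blocks of geometrically increasing lengths. -/
noncomputable def geometricSchedule (d : ℕ) : Schedule where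
  -- For `d > 0`, block `j ≥ 1` is `d * 4 ^ j ≤ m < d * 4 ^ (j + 1)`; block `0` is `m < 4 * d`,
  -- since `Nat.log 4 0 = 0`. With `L = log (8 * 4 ^ j)`, the rate solves `d * L / η = d * 4 ^ (j +
  -- 1) * η`, which balances the two regret terms.
  colour m := Nat.log 4 (m / d)
  mesh j := 2 ^ j
  rate j := √(Real.log (8 * 4 ^ j)) / (2 * 2 ^ j)
  mesh_pos j := by positivity
  rate_pos j := by
    have h1 : (1 : ℝ) ≤ 4 ^ j := one_le_pow₀ (by norm_num)
    have : 0 < Real.log (8 * 4 ^ j) := Real.log_pos (by linarith)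
    positivity
  rate_le_one j := by
    have h1 : (0 : ℝ) < 4 ^ j := by positivity
    rw [div_le_one (by positivity)]
    refine Real.sqrt_le_iff.2 ⟨by positivity, ?_⟩
    have h2 : Real.log (8 * 4 ^ j) = Real.log 2 + Real.log (4 * 4 ^ j) := by
      rw [← Real.log_mul (by norm_num) (by positivity)]
      ring_nf
    have h3 := Real.log_le_sub_one_of_pos (show (0 : ℝ) < 4 * 4 ^ j by positivity)
    have h4 := Real.log_two_lt_d9
    have h5 : ((2 : ℝ) * 2 ^ j) ^ 2 = 4 * 4 ^ j := by
      rw [mul_pow, ← pow_mul, mul_comm j 2, pow_mul]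
      norm_num
    rw [h2, h5]
    linarith

/-- With `d = |Ω|`, the boxes number at most `(4 * 4 ^ j) ^ d`, and the factor `2 * |J|` for
coordinate and sign is absorbed in `2 ^ d`. -/
theorem log_card_expert_le {Ω : Type*} [Fintype Ω] (J : Finset Ω) (j : ℕ) :
    Real.log (Fintype.card (Expert J (2 ^ j))) ≤ Fintype.card Ω * Real.log (8 * 4 ^ j) := by
  have h1 : (1 : ℝ) ≤ 4 ^ j := one_le_pow₀ (by norm_num)
  rcases J.card.eq_zero_or_pos with h0 | h0
  · rw [card_expert, h0]
    simpa using mul_nonneg (Nat.cast_nonneg (Fintype.card Ω))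
      (Real.log_nonneg (show (1 : ℝ) ≤ 8 * 4 ^ j by linarith))
  set d := Fintype.card Ω with hd
  have hJd : J.card ≤ d := Finset.card_le_univ J
  have h2 : 2 * J.card ≤ 2 ^ d := by
    obtain ⟨c, hc⟩ : ∃ c, d = c + 1 := ⟨d - 1, by omega⟩
    have := Nat.lt_two_pow_self (n := c)
    rw [hc, pow_succ]
    omega
  have h3 : Fintype.card (Expert J (2 ^ j)) ≤ (8 * 4 ^ j) ^ d := by
    rw [card_expert]
    have h4 : (2 ^ j + 1) ^ 2 ≤ 4 * 4 ^ j := by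
      have : 2 ^ j + 1 ≤ 2 * 2 ^ j := by
        have := Nat.one_le_two_pow (n := j)
        omega
      calc (2 ^ j + 1) ^ 2 ≤ (2 * 2 ^ j) ^ 2 := Nat.pow_le_pow_left this 2
        _ = 4 * 4 ^ j := by
          rw [mul_pow, ← pow_mul, mul_comm j 2, pow_mul]
          norm_num
    calc ((2 ^ j + 1) ^ 2) ^ J.card * (2 * J.card) ≤ (4 * 4 ^ j) ^ d * 2 ^ d :=
          Nat.mul_le_mul ((Nat.pow_le_pow_left h4 _).trans
            (Nat.pow_le_pow_right (by positivity) hJd)) h2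
      _ = (8 * 4 ^ j) ^ d := by
          rw [← mul_pow]
          ring_nf
  rw [← Real.log_pow]
  refine Real.log_le_log ?_ (by exact_mod_cast h3)
  rw [card_expert]
  positivity

theorem card_colour_le {d : ℕ} (hd : 0 < d) (n j : ℕ) :
    ((Finset.range n).filter fun m => (geometricSchedule d).colour m = j).card ≤ d * 4 ^ (j + 1) := by
  rw [← Finset.card_range (d * 4 ^ (j + 1))]
  refine Finset.card_le_card fun m hm => ?_
  have h1 : Nat.log 4 (m / d) = j := (Finset.mem_filter.1 hm).2
  have h2 : m / d < 4 ^ (j + 1) := h1 ▸ Nat.lt_pow_succ_log_self (by norm_num) _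
  rw [Finset.mem_range, mul_comm]
  exact (Nat.div_lt_iff_lt_mul hd).1 h2

/-- Block `j` costs a multiple of `2 ^ j`, so the geometric sum is at most twice the contribution of
the last block. -/
theorem sum_geometricSchedule_le {Ω : Type*} [Fintype Ω] [Nonempty Ω] (J : Finset Ω) (n k : ℕ)
    (hk : ∀ m < n, (geometricSchedule (Fintype.card Ω)).colour m < k + 1) :
    let S := geometricSchedule (Fintype.card Ω)
    ∑ j ∈ Finset.range (k + 1), Real.log (Fintype.card (Expert J (S.mesh j))) / S.rate j +
        ∑ m ∈ Finset.range n, (S.rate (S.colour m) + 1 / S.mesh (S.colour m)) ≤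
      8 * Fintype.card Ω * 2 ^ k * (√(Real.log (8 * 4 ^ k)) + 1) := by
  intro S
  set d := Fintype.card Ω with hd
  have hd0 : 0 < d := Fintype.card_pos
  have hmaps : ∀ m ∈ Finset.range n, S.colour m ∈ Finset.range (k + 1) := fun m hm =>
    Finset.mem_range.2 (hk m (Finset.mem_range.1 hm))
  rw [← Finset.sum_fiberwise_of_maps_to hmaps, ← Finset.sum_add_distrib]
  have hterm : ∀ j ∈ Finset.range (k + 1),
      Real.log (Fintype.card (Expert J (S.mesh j))) / S.rate j +
        ∑ m ∈ Finset.range n with S.colour m = j, (S.rate (S.colour m) + 1 / S.mesh (S.colour m)) ≤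
      2 ^ j * (4 * d * (√(Real.log (8 * 4 ^ k)) + 1)) := by
    intro j hj
    have hjk : j ≤ k := Nat.lt_succ_iff.1 (Finset.mem_range.1 hj)
    have h41 : (1 : ℝ) ≤ 4 ^ j := one_le_pow₀ (by norm_num)
    have hLpos : 0 < Real.log (8 * 4 ^ j) := Real.log_pos (by linarith)
    have hL : √(Real.log (8 * 4 ^ j)) ≤ √(Real.log (8 * 4 ^ k)) := by
      refine Real.sqrt_le_sqrt (Real.log_le_log (by positivity) ?_)
      exact mul_le_mul_of_nonneg_left (pow_le_pow_right₀ (by norm_num) hjk) (by norm_num)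
    set s := √(Real.log (8 * 4 ^ j)) with hs
    have hspos : 0 < s := Real.sqrt_pos.2 hLpos
    have hsq : s * s = Real.log (8 * 4 ^ j) := Real.mul_self_sqrt hLpos.le
    have hrate : S.rate j = s / (2 * 2 ^ j) := rfl
    have hmesh : (S.mesh j : ℝ) = 2 ^ j := by
      change ((2 ^ j : ℕ) : ℝ) = 2 ^ j
      push_cast
      rfl
    have h1 : Real.log (Fintype.card (Expert J (S.mesh j))) / S.rate j ≤ 2 ^ j * (2 * d * s) := by
      rw [div_le_iff₀ (S.rate_pos j), hrate]
      refine (log_card_expert_le J j).trans (le_of_eq ?_)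
      rw [← hsq, ← hd]
      field_simp
    have h2 : ∑ m ∈ Finset.range n with S.colour m = j,
        (S.rate (S.colour m) + 1 / S.mesh (S.colour m)) ≤ 2 ^ j * (2 * d * s + 4 * d) := by
      have h3 : ∑ m ∈ Finset.range n with S.colour m = j,
          (S.rate (S.colour m) + 1 / (S.mesh (S.colour m) : ℝ)) =
          ((Finset.range n).filter fun m => S.colour m = j).card *
            (s / (2 * 2 ^ j) + 1 / 2 ^ j) := by
        rw [← nsmul_eq_mul, ← Finset.sum_const]
        refine Finset.sum_congr rfl fun m hm => ?_
        rw [(Finset.mem_filter.1 hm).2, hrate, hmesh]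
      rw [h3]
      have h4 : (((Finset.range n).filter fun m => S.colour m = j).card : ℝ) ≤ d * 4 ^ (j + 1) := by
        exact_mod_cast card_colour_le hd0 n j
      refine (mul_le_mul_of_nonneg_right h4 (by positivity)).trans (le_of_eq ?_)
      have h5 : (4 : ℝ) ^ (j + 1) = 4 * (2 ^ j * 2 ^ j) := by
        rw [pow_succ, ← mul_pow]
        norm_num
        ring
      rw [h5]
      field_simp
      ring
    have hd' : (0 : ℝ) < d := Nat.cast_pos.2 hd0
    calc _ ≤ 2 ^ j * (2 * d * s) + 2 ^ j * (2 * d * s + 4 * d) := add_le_add h1 h2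
      _ = 2 ^ j * (4 * d * (s + 1)) := by ring
      _ ≤ _ := by gcongr
  refine (Finset.sum_le_sum hterm).trans ?_
  rw [← Finset.sum_mul, geom_sum_eq (by norm_num)]
  have hd' : (0 : ℝ) ≤ 4 * d * (√(Real.log (8 * 4 ^ k)) + 1) := by positivity
  have h6 : ((2 : ℝ) ^ (k + 1) - 1) / (2 - 1) ≤ 2 * 2 ^ k := by
    rw [pow_succ]
    linarith
  refine (mul_le_mul_of_nonneg_right h6 hd').trans (le_of_eq ?_)
  ring

theorem log_two_mul_pos {d n : ℕ} (hd : 0 < d) (hn : d ≤ n) :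
    Real.log 2 ≤ Real.log (2 * n / d) := by
  have hd' : (0 : ℝ) < d := Nat.cast_pos.2 hd
  have hn' : (d : ℝ) ≤ n := Nat.cast_le.2 hn
  refine Real.log_le_log (by norm_num) ?_
  rw [le_div_iff₀ hd']
  linarith

/-- For `n ≤ 16 * d` the claimed rate exceeds the trivial bound `1` on the score, so the real
estimate may assume `n / d > 16`. -/
theorem one_le_rate_of_le {d n : ℕ} (hd : 0 < d) (hn : d ≤ n) (h : n ≤ 16 * d) :
    1 ≤ 12 * √(2 * ((d : ℝ) / n) * Real.log (2 * n / d)) := by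
  have hd' : (0 : ℝ) < d := Nat.cast_pos.2 hd
  have hn' : (0 : ℝ) < n := Nat.cast_pos.2 (hd.trans_le hn)
  have h1 := log_two_mul_pos hd hn
  have h2 := Real.log_two_gt_d9
  have h3 : (1 / 16 : ℝ) ≤ d / n := by
    rw [div_le_div_iff₀ (by norm_num) hn']
    have : (n : ℝ) ≤ 16 * d := by exact_mod_cast h
    linarith
  have h4 : (1 / 12 : ℝ) ≤ √(2 * ((d : ℝ) / n) * Real.log (2 * n / d)) := by
    refine Real.le_sqrt_of_sq_le ?_
    calc ((1 : ℝ) / 12) ^ 2 ≤ 2 * (1 / 16) * (1 / 2) := by norm_num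
      _ ≤ _ := by
        gcongr
        linarith
  linarith

theorem rate_bound {d n k : ℕ} (hd : 0 < d) (hn : 16 * d < n) (hk : d * 4 ^ k ≤ n) :
    8 * d * 2 ^ k * (√(Real.log (8 * 4 ^ k)) + 1) / n ≤
      12 * √(2 * ((d : ℝ) / n) * Real.log (2 * n / d)) := by
  have hd' : (0 : ℝ) < d := Nat.cast_pos.2 hd
  have hn1 : (16 : ℝ) * d < n := by exact_mod_cast hn
  have hn' : (0 : ℝ) < n := by linarith
  set x : ℝ := n / d with hx
  have hx0 : 0 < x := by positivity
  have hx16 : 16 < x := by rw [hx, lt_div_iff₀ hd']; exact hn1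
  have hxk : (4 : ℝ) ^ k ≤ x := by
    rw [hx, le_div_iff₀ hd', mul_comm]
    exact_mod_cast hk
  have hdn : (d : ℝ) / n = 1 / x := by rw [hx, one_div_div]
  have h2n : 2 * (n : ℝ) / d = 2 * x := by rw [hx]; ring
  set y := Real.log (2 * x) with hy
  have hl2 := Real.log_two_gt_d9
  have hy5 : 5 * Real.log 2 ≤ y := by
    rw [hy, ← Real.log_rpow (by norm_num)]
    refine Real.log_le_log (by positivity) ?_
    norm_num
    linarith
  have hL : Real.log (8 * 4 ^ k) ≤ 2 * Real.log 2 + y := by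
    rw [hy, ← Real.log_rpow (by norm_num), ← Real.log_mul (by positivity) (by positivity)]
    refine Real.log_le_log (by positivity) ?_
    norm_num
    linarith
  -- From `y ≥ 5 * log 2`, the logarithm is at most `7 / 5 * y`, and `7 / 5 ≤ (6 / 5) ^ 2`. The
  -- final constant is `8 * (6 / 5 + 3 / 5) = 72 / 5 ≤ 16 = 12 * (4 / 3) ≤ 12 * √2`.
  have hs1 : √(Real.log (8 * 4 ^ k)) ≤ 6 / 5 * √y := by
    rw [Real.sqrt_le_left (by positivity), mul_pow, Real.sq_sqrt (by linarith)]
    linarith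
  have hs2 : 1 ≤ 3 / 5 * √y := by
    have : (5 / 3 : ℝ) ≤ √y := Real.le_sqrt_of_sq_le (by linarith)
    linarith
  have h2k : (2 : ℝ) ^ k ≤ √x := by
    refine Real.le_sqrt_of_sq_le ?_
    rw [← pow_mul, mul_comm, pow_mul]
    norm_num
    exact hxk
  have hsx : 0 < √x := Real.sqrt_pos.2 hx0
  have hrhs : √(2 * ((d : ℝ) / n) * Real.log (2 * n / d)) = √2 * √y / √x := by
    rw [hdn, h2n, ← hy, ← Real.sqrt_mul (by norm_num), ← Real.sqrt_div (by linarith)]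
    congr 1
    ring
  rw [hrhs]
  have hlhs : 8 * d * 2 ^ k * (√(Real.log (8 * 4 ^ k)) + 1) / n =
      8 * (2 ^ k * (√(Real.log (8 * 4 ^ k)) + 1)) / (√x * √x) := by
    rw [Real.mul_self_sqrt hx0.le, hx]
    field_simp
  rw [hlhs]
  have hs3 : (4 / 3 : ℝ) ≤ √2 := Real.le_sqrt_of_sq_le (by norm_num)
  calc 8 * (2 ^ k * (√(Real.log (8 * 4 ^ k)) + 1)) / (√x * √x)
      ≤ 8 * (√x * (6 / 5 * √y + 3 / 5 * √y)) / (√x * √x) := by gcongr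
    _ = 72 / 5 * √y / √x := by field_simp; ring
    _ ≤ 16 * √y / √x := by gcongr; norm_num
    _ = 12 * (4 / 3 * √y / √x) := by ring
    _ ≤ 12 * (√2 * √y / √x) := by gcongr

theorem integral_supScore_geometricSchedule_le {Ω : Type*} [Fintype Ω] [Nonempty Ω]
    [MeasurableSpace Ω] [DiscreteMeasurableSpace Ω] (J : Finset Ω) (τ : Strategy Ω Ω) {n : ℕ}
    (hn : Fintype.card Ω ≤ n) :
    ∫ h, supScore J (supBalls J) n h
        ∂(playLaw (calibratedStrategy (geometricSchedule (Fintype.card Ω)) J) τ) ≤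
      12 * √(2 * ((Fintype.card Ω : ℝ) / n) * Real.log (2 * n / Fintype.card Ω)) := by
  have hd : 0 < Fintype.card Ω := Fintype.card_pos
  rcases le_or_gt n (16 * Fintype.card Ω) with h16 | h16
  · refine le_trans ?_ (one_le_rate_of_le hd hn h16)
    calc _ ≤ ∫ _, (1 : ℝ) ∂(playLaw (calibratedStrategy (geometricSchedule (Fintype.card Ω)) J) τ) :=
          integral_mono (integrable_supScore _ J τ _ n) (integrable_const _)
            fun h => supScore_le_one J _ n h
      _ = 1 := by simp
  · have hk : ∀ m < n, (geometricSchedule (Fintype.card Ω)).colour m <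
        Nat.log 4 (n / Fintype.card Ω) + 1 := fun m hm =>
      Nat.lt_succ_of_le (Nat.log_mono_right (b := 4) (Nat.div_le_div_right hm.le))
    refine (integral_supScore_le _ J τ hk).trans ?_
    refine (div_le_div_of_nonneg_right (sum_geometricSchedule_le J n _ hk)
      (Nat.cast_nonneg n)).trans (rate_bound hd h16 ?_)
    have h1 := Nat.pow_log_le_self 4 (Nat.div_pos hn hd).ne'
    calc _ ≤ Fintype.card Ω * (n / Fintype.card Ω) := Nat.mul_le_mul_left _ h1
      _ ≤ n := Nat.mul_div_le n _

end Schedule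

/-! ### From expectation to almost sure convergence. -/

section AlmostSure

variable {Ω : Type*} [Fintype Ω]

theorem monotone_mul_supScore_add (J : Finset Ω) (𝓕 : Set (Set (Prediction Ω)))
    (h : ℕ → Stage Ω) : Monotone fun n : ℕ => n * supScore J 𝓕 n h + n := by
  refine monotone_nat_of_le_succ fun n => ?_
  have := supScore_lipschitz J 𝓕 n h
  push_cast at this ⊢
  linarith

/-- Convergence of the scores along a sparse sequence of stages is enough. -/
theorem tendsto_supScore_of_tendsto_pow (J : Finset Ω) (𝓕 : Set (Set (Prediction Ω)))
    (h : ℕ → Stage Ω)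
    (H : Tendsto (fun k : ℕ => supScore J 𝓕 (k ^ 8) h) atTop (nhds 0)) :
    Tendsto (fun n => supScore J 𝓕 n h) atTop (nhds 0) := by
  have hdiv : ∀ n : ℕ, 0 < n →
      (n * supScore J 𝓕 n h + n) / (n : ℝ) = supScore J 𝓕 n h + 1 := fun n hn => by
    have : (n : ℝ) ≠ 0 := Nat.cast_ne_zero.2 hn.ne'
    field_simp
  -- Adding `n` makes `n * score` monotone, and `(k + 1) ^ 8 / k ^ 8` tends to `1`; so the limit `1`
  -- of the quotients along `k ^ 8` extends to all `n`.
  have h1 := tendsto_div_of_monotone_of_exists_subseq_tendsto_div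
    (fun n : ℕ => n * supScore J 𝓕 n h + n) 1 (monotone_mul_supScore_add J 𝓕 h) fun a ha => by
      refine ⟨fun k => k ^ 8, ?_, tendsto_pow_atTop (by norm_num), ?_⟩
      · have h2 : Tendsto (fun k : ℕ => (1 + 1 / (k : ℝ)) ^ 8) atTop (nhds 1) := by
          simpa using (tendsto_one_div_atTop_nhds_zero_nat (𝕜 := ℝ)).const_add 1 |>.pow 8
        filter_upwards [h2.eventually_le_const ha, eventually_gt_atTop 0] with k hk hk0
        have hk' : (0 : ℝ) < k := Nat.cast_pos.2 hk0
        have h3 : ((k + 1 : ℕ) : ℝ) = (1 + 1 / (k : ℝ)) * k := by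
          push_cast
          field_simp
        push_cast at h3 ⊢
        rw [h3, mul_pow]
        exact mul_le_mul_of_nonneg_right hk (by positivity)
      · have h2 : Tendsto (fun k : ℕ => supScore J 𝓕 (k ^ 8) h + 1) atTop (nhds 1) := by
          simpa using H.add_const 1
        refine h2.congr' ?_
        filter_upwards [eventually_gt_atTop 0] with k hk
        exact (hdiv (k ^ 8) (by positivity)).symm
  have h2 : Tendsto (fun n : ℕ => (n * supScore J 𝓕 n h + n) / (n : ℝ) - 1) atTop (nhds 0) := by
    simpa using h1.sub_const 1
  refine h2.congr' ?_
  filter_upwards [eventually_gt_atTop 0] with n hn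
  rw [hdiv n hn]
  ring

theorem limsup_euclideanScore_le (J : Finset Ω) (𝓕 : Set (Set (Prediction Ω))) (h : ℕ → Stage Ω)
    (H : Tendsto (fun n => supScore J 𝓕 n h) atTop (nhds 0)) :
    limsup (fun n : ℕ => euclideanScore J 𝓕 n h) atTop ≤ 0 := by
  have h1 : Tendsto (fun n : ℕ => √J.card * supScore J 𝓕 n h) atTop (nhds 0) := by
    simpa using H.const_mul √J.card
  exact (squeeze_zero (fun n => euclideanScore_nonneg J 𝓕 n h)
    (fun n => euclideanScore_le J 𝓕 n h) h1).limsup_eq.le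

/-- At `n = k ^ 8` the crude bound `log (2 * k ^ 8 / d) ≤ 3 * k ^ 4` still leaves a summable `1 / k
^ 2`. -/
theorem rate_pow_le {d k : ℕ} (hd : 0 < d) (hk : 0 < k) :
    12 * √(2 * ((d : ℝ) / (k ^ 8 : ℕ)) * Real.log (2 * (k ^ 8 : ℕ) / d)) ≤
      12 * √(6 * d) * (1 / (k : ℝ) ^ 2) := by
  have hd' : (1 : ℝ) ≤ d := Nat.one_le_cast.2 hd
  have hk' : (0 : ℝ) < k := Nat.cast_pos.2 hk
  push_cast
  have h1 : Real.log (2 * (k : ℝ) ^ 8 / d) ≤ 3 * k ^ 4 := by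
    calc Real.log (2 * (k : ℝ) ^ 8 / d) ≤ Real.log (2 * (k : ℝ) ^ 8) :=
          Real.log_le_log (by positivity) (div_le_self (by positivity) hd')
      _ = Real.log 2 + 2 * Real.log ((k : ℝ) ^ 4) := by
          rw [Real.log_mul (by norm_num) (by positivity), Real.log_pow, Real.log_pow]
          push_cast
          ring
      _ ≤ 3 * k ^ 4 := by
          have h2 := Real.log_le_sub_one_of_pos (show (0 : ℝ) < (k : ℝ) ^ 4 by positivity)
          have h3 := Real.log_two_lt_d9
          have h4 : (0 : ℝ) < (k : ℝ) ^ 4 := by positivity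
          linarith
  have h2 : 2 * ((d : ℝ) / k ^ 8) * Real.log (2 * (k : ℝ) ^ 8 / d) ≤
      (√(6 * d) * (1 / (k : ℝ) ^ 2)) ^ 2 := by
    rw [mul_pow, Real.sq_sqrt (by positivity)]
    calc _ ≤ 2 * ((d : ℝ) / k ^ 8) * (3 * k ^ 4) := by gcongr
      _ = _ := by
        field_simp
        ring
  rw [mul_assoc 12 (√(6 * d))]
  exact mul_le_mul_of_nonneg_left (Real.sqrt_le_iff.2 ⟨by positivity, h2⟩) (by norm_num)

variable [Nonempty Ω] [MeasurableSpace Ω] [DiscreteMeasurableSpace Ω]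

/-- Nonnegative variables with summable expectations have an almost surely finite sum, hence tend to
zero; no concentration inequality is needed. -/
theorem ae_tendsto_supScore (J : Finset Ω) (τ : Strategy Ω Ω) :
    ∀ᵐ h ∂(playLaw (calibratedStrategy (geometricSchedule (Fintype.card Ω)) J) τ),
      Tendsto (fun n => supScore J (supBalls J) n h) atTop (nhds 0) := by
  set S := geometricSchedule (Fintype.card Ω)
  set P := playLaw (calibratedStrategy S J) τ
  have hd : 0 < Fintype.card Ω := Fintype.card_pos
  have hint : ∀ k, Integrable (fun h => supScore J (supBalls J) (k ^ 8) h) P := fun k =>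
    integrable_supScore S J τ _ _
  have hsum : Summable fun k : ℕ => ∫ h, supScore J (supBalls J) (k ^ 8) h ∂P := by
    have h2 : Summable fun k : ℕ => 12 * √(6 * Fintype.card Ω) * (1 / (k : ℝ) ^ 2) :=
      (Real.summable_one_div_nat_pow.2 (by norm_num)).mul_left _
    refine h2.of_norm_bounded_eventually_nat ?_
    filter_upwards [eventually_ge_atTop (Fintype.card Ω)] with k hk
    have hk0 : 0 < k := hd.trans_le hk
    rw [Real.norm_eq_abs, abs_of_nonneg (integral_nonneg fun h => supScore_nonneg J _ _ h)]
    exact (integral_supScore_geometricSchedule_le J τ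
      (hk.trans (Nat.le_self_pow (by norm_num) k))).trans (rate_pow_le hd hk0)
  have hne : ∑' k, ∫⁻ h, ENNReal.ofReal (supScore J (supBalls J) (k ^ 8) h) ∂P ≠ ⊤ := by
    have h1 : ∀ k, ∫⁻ h, ENNReal.ofReal (supScore J (supBalls J) (k ^ 8) h) ∂P =
        ENNReal.ofReal (∫ h, supScore J (supBalls J) (k ^ 8) h ∂P) := fun k =>
      (ofReal_integral_eq_lintegral_ofReal (hint k)
        (Eventually.of_forall fun h => supScore_nonneg J _ _ h)).symm
    simp only [h1]
    exact hsum.tsum_ofReal_ne_top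
  have hmeas : ∀ k, AEMeasurable
      (fun h => ENNReal.ofReal (supScore J (supBalls J) (k ^ 8) h)) P := fun k =>
    (hint k).aestronglyMeasurable.aemeasurable.ennreal_ofReal
  rw [← lintegral_tsum hmeas] at hne
  filter_upwards [ae_lt_top' (AEMeasurable.tsum hmeas) hne] with h hh
  refine tendsto_supScore_of_tendsto_pow J _ h ?_
  have h2 := (ENNReal.tendsto_toReal ENNReal.zero_ne_top).comp
    (ENNReal.tendsto_cofinite_zero_of_tsum_ne_top hh.ne)
  rw [Nat.cofinite_eq_atTop] at h2
  simpa [Function.comp_def, ENNReal.toReal_ofReal, supScore_nonneg] using h2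

theorem isCalibrated_calibratedStrategy (J : Finset Ω) :
    IsCalibrated J (supBalls J)
      (calibratedStrategy (geometricSchedule (Fintype.card Ω)) J) := by
  intro τ
  filter_upwards [ae_tendsto_supScore J τ] with h hh
  exact limsup_euclideanScore_le J _ h hh

end AlmostSure

end Calibration

theorem mainTheorem6 {Ω : Type*} [Fintype Ω] [Nonempty Ω] [MeasurableSpace Ω]
    [DiscreteMeasurableSpace Ω] (J : Finset Ω) (hJ : Fintype.card Ω ≤ J.card + 1) :
    ∃ σ : Calibration.Strategy Ω (Calibration.Prediction Ω),
      Calibration.IsCalibrated J (Calibration.supBalls J) σ ∧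
      ∀ (τ : Calibration.Strategy Ω Ω) (n : ℕ), Fintype.card Ω ≤ n →
        Integrable (fun h => Calibration.supScore J (Calibration.supBalls J) n h)
          (Calibration.playLaw σ τ) ∧
        ∫ h, Calibration.supScore J (Calibration.supBalls J) n h ∂(Calibration.playLaw σ τ) ≤
          12 * √(2 * ((Fintype.card Ω : ℝ) / n) * Real.log (2 * n / Fintype.card Ω)) :=
  ⟨Calibration.calibratedStrategy (Calibration.geometricSchedule (Fintype.card Ω)) J,
    Calibration.isCalibrated_calibratedStrategy J, fun τ _ hn =>
      ⟨Calibration.integrable_supScore _ J τ _ _,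
        Calibration.integral_supScore_geometricSchedule_le J τ hn⟩⟩
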